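/- A $*$-noncommutative probability space is a pair $(\mathcal A,\tau)$ with $\mathcal A$ a unital complex $*$-algebra and $\tau:\mathcal A\to\mathbb C$ a linear functional with $\tau(1)=1$ and $\tau(a^*a)\ge 0$ for all $a\in\mathcal A$. For $n\in\mathbb N$ let $T_n$ be the random strictly upper triangular $n\times n$ matrix whose entries above the diagonal are independent complex Gaussian random variables, the real and imaginary parts of each being independent, centred, of variance $\frac1{2n}$; let $\tau_n$ denote the expectation of the normalized trace. Given a compactly supported Borel probability measure $\mu$ on $\mathbb C$ and $c>0$, let $D_n$ be a diagonal random matrix, independent of $T_n$, with i.i.d. $\mu$-distributed diagonal entries, and let $Z_n=D_n+cT_n$. An element $z\in\mathcal A$ is a $\mathrm{DT}(\mu,c)$-element if $\tau(z^{\epsilon(1)}\cdots z^{\epsilon(k)})=\lim_{n\to\infty}\tau_n(Z_n^{\epsilon(1)}\cdots Z_n^{\epsilon(k)})$ for all $k$ and all $\epsilon(1),\dots,\epsilon(k)\in\{1,*\}$. The distribution of $a\in\mathcal A$ is the linear functional $\nu$ on $\mathbb C[X]$ given by $\nu(P)=\tau(P(a))$. Its Cauchy transform is $G_\nu(w)=\sum_{p\ge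 0}\nu(X^p)w^{-p-1}$, and when this series converges for $|w|$ large, its R-transform is the function $R_\nu$, analytic in a neighbourhood of $0$ in $\mathbb C$, such that $G_\nu\big(R_\nu(z)+\tfrac1z\big)=z$ for all sufficiently small $z\ne 0$ (that is, $R_\nu(z)=G_\nu^{\langle -1\rangle}(z)-\frac1z$); it is unique as a germ at $0$. **Theorem.** Let $T$ be a $\mathrm{DT}(\delta_0,1)$-element (a quasinilpotent DT-element) of a $*$-noncommutative probability space $(\mathcal A,\tau)$. (a) For every integer $p\ge 1$, $$\tau\big((T^*T)^p\big)=\frac{p^p}{(p+1)!}.$$ (b) If $\nu$ is the distribution of $T^*T$, then its R-transform exists and is given by $$R_\nu(z)=\frac{-1}{(1-z)\log(1-z)}-\frac1z$$ for all $z\ne 0$ with $|z|$ sufficiently small, where $\log$ is the principal branch. -/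

import Mathlib

open MeasureTheory ProbabilityTheory Filter Topology Polynomial
open scoped NNReal Nat ComplexOrder

noncomputable section

/-- `(A, τ)` is a `*`-noncommutative probability space: the linear functional `τ` on the unital
complex `*`-algebra `A` is unital and positive. -/
structure IsStarProbability {A : Type*} [Ring A] [StarRing A] [Algebra ℂ A] [StarModule ℂ A]
    (τ : A →ₗ[ℂ] ℂ) : Prop where
  map_one : τ 1 = 1
  nonneg : ∀ a : A, 0 ≤ τ (star a * a)

/-- The word `z^{ε(1)} ⋯ z^{ε(k)}` in `z` and `z*`; a letter `true` stands for `z*` and a letter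
`false` for `z`. -/
def starWord {A : Type*} [Monoid A] [Star A] (z : A) (ε : List Bool) : A :=
  (ε.map fun b => if b then star z else z).prod

/-- The law of a complex `N(0, v)` random variable: real and imaginary parts are independent
centred real Gaussians of variance `v / 2`. -/
def complexGaussian (v : ℝ≥0) : Measure ℂ :=
  ((gaussianReal 0 (v / 2)).prod (gaussianReal 0 (v / 2))).map Complex.measurableEquivRealProd.symm

/-- Index set of the entries strictly above the diagonal of an `n × n` matrix. -/
abbrev UpperIndex (n : ℕ) : Type := {p : Fin n × Fin n // p.1 < p.2}

/-- The strictly upper triangular matrix with the given entries above the diagonal. -/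
def upperMatrix {n : ℕ} (t : UpperIndex n → ℂ) : Matrix (Fin n) (Fin n) ℂ :=
  Matrix.of fun i j => if h : i < j then t ⟨(i, j), h⟩ else 0

/-- The sample space carrying the diagonal entries of `D_n` and the upper entries of `T_n`. -/
abbrev DTSample (n : ℕ) : Type := (Fin n → ℂ) × (UpperIndex n → ℂ)

/-- The joint law: the diagonal entries are i.i.d. with law `μ`, the upper entries are i.i.d.
complex `N(0, 1/n)`, and the two families are independent. -/
def dtLaw (μ : Measure ℂ) [IsProbabilityMeasure μ] (n : ℕ) : Measure (DTSample n) :=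
  (Measure.pi fun _ : Fin n => μ).prod
    (Measure.pi fun _ : UpperIndex n => complexGaussian (1 / (n : ℝ≥0)))

/-- The random matrix `Z_n = D_n + c T_n`. -/
def dtMatrix (c : ℝ) {n : ℕ} (ω : DTSample n) : Matrix (Fin n) (Fin n) ℂ :=
  Matrix.diagonal ω.1 + (c : ℂ) • upperMatrix ω.2

/-- `τ_n (Z_n^{ε(1)} ⋯ Z_n^{ε(k)})`: the expectation of the normalized trace. -/
def dtMoment (μ : Measure ℂ) [IsProbabilityMeasure μ] (c : ℝ) (n : ℕ) (ε : List Bool) : ℂ :=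
  ∫ ω, (starWord (dtMatrix c ω) ε).trace / (n : ℂ) ∂(dtLaw μ n)

/-- `z` is a `DT(μ, c)`-element of `(A, τ)`. -/
structure IsDTElement {A : Type*} [Ring A] [StarRing A] [Algebra ℂ A] [StarModule ℂ A]
    (τ : A →ₗ[ℂ] ℂ) (μ : Measure ℂ) [IsProbabilityMeasure μ] (c : ℝ) (z : A) : Prop where
  compact_support : ∃ K : Set ℂ, IsCompact K ∧ μ Kᶜ = 0
  pos : 0 < c
  tendsto_moment : ∀ ε : List Bool,
    Tendsto (fun n : ℕ => dtMoment μ c n ε) atTop (𝓝 (τ (starWord z ε)))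

/-- The distribution of `a` with respect to `τ`: the functional `P ↦ τ (P (a))` on `ℂ[X]`. -/
def distribution {A : Type*} [Ring A] [Algebra ℂ A] (τ : A →ₗ[ℂ] ℂ) (a : A) : ℂ[X] →ₗ[ℂ] ℂ :=
  τ ∘ₗ (aeval a : ℂ[X] →ₐ[ℂ] A).toLinearMap

/-- The Cauchy transform `G_ν(w) = ∑_{p ≥ 0} ν(X^p) w^{-p-1}` converges at `w`, with value `s`. -/
def HasCauchyTransform (ν : ℂ[X] →ₗ[ℂ] ℂ) (w s : ℂ) : Prop :=
  HasSum (fun p : ℕ => ν (X ^ p) / w ^ (p + 1)) s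

/-- `R` is the R-transform of `ν` near `0`: it is analytic at `0`, and `R(z) + 1/z` is the
compositional inverse of the Cauchy transform `G_ν` near infinity, that is `G_ν(R(z) + 1/z) = z`
for all small `z ≠ 0`. This determines `R` near `0` by `IsRTransform.eventuallyEq`. -/
structure IsRTransform (ν : ℂ[X] →ₗ[ℂ] ℂ) (R : ℂ → ℂ) : Prop where
  analyticAt : AnalyticAt ℂ R 0
  hasCauchyTransform : ∀ᶠ z in 𝓝[≠] (0 : ℂ), HasCauchyTransform ν (R z + 1 / z) z

theorem IsRTransform.tendsto_inv {ν : ℂ[X] →ₗ[ℂ] ℂ} {R : ℂ → ℂ} (h : IsRTransform ν R) :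
    Tendsto (fun z => (R z + 1 / z)⁻¹) (𝓝[≠] (0 : ℂ)) (𝓝 0) ∧
      ∀ᶠ z in 𝓝[≠] (0 : ℂ), (R z + 1 / z) ≠ 0 := by
  have hc : ContinuousAt (fun z : ℂ => z / (z * R z + 1)) 0 := by
    have := h.analyticAt.continuousAt
    refine continuousAt_id.div ((continuousAt_id.mul this).add continuousAt_const) ?_
    simp
  have hne : ∀ᶠ z in 𝓝[≠] (0 : ℂ), z * R z + 1 ≠ 0 := by
    have h1 : ContinuousAt (fun z : ℂ => z * R z + 1) 0 :=
      (continuousAt_id.mul h.analyticAt.continuousAt).add continuousAt_const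
    exact (h1.eventually_ne (by simp)).filter_mono nhdsWithin_le_nhds
  have hz : ∀ᶠ z in 𝓝[≠] (0 : ℂ), z ≠ 0 := self_mem_nhdsWithin
  refine ⟨?_, ?_⟩
  · have h0 : Tendsto (fun z : ℂ => z / (z * R z + 1)) (𝓝[≠] 0) (𝓝 0) := by
      have := hc.tendsto.mono_left (nhdsWithin_le_nhds (s := {0}ᶜ))
      simpa using this
    refine h0.congr' ?_
    filter_upwards [hz] with z hz
    have : R z + 1 / z = (z * R z + 1) / z := by field_simp
    rw [this, inv_div]
  · filter_upwards [hz, hne] with z hz hne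
    have : R z + 1 / z = (z * R z + 1) / z := by field_simp
    rw [this]
    exact div_ne_zero hne hz

/-- The R-transform of a unital functional is unique as a germ at `0`. -/
theorem IsRTransform.eventuallyEq {ν : ℂ[X] →ₗ[ℂ] ℂ} (hν : ν 1 = 1) {R S : ℂ → ℂ}
    (hR : IsRTransform ν R) (hS : IsRTransform ν S) : R =ᶠ[𝓝 0] S := by
  obtain ⟨tR, nR⟩ := hR.tendsto_inv
  obtain ⟨tS, nS⟩ := hS.tendsto_inv
  let q : FormalMultilinearSeries ℂ ℂ ℂ := .ofScalars ℂ (fun p : ℕ => ν (X ^ p))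
  obtain ⟨z₀, hz₀, hn₀⟩ := (hR.hasCauchyTransform.and nR).exists
  have hrad : 0 < q.radius := by
    have hb : Tendsto (fun p : ℕ => ‖q p‖ * (‖(R z₀ + 1 / z₀)⁻¹‖₊ : ℝ) ^ p) atTop (𝓝 0) := by
      have h1 := (hz₀.summable.tendsto_atTop_zero.norm).mul_const ‖R z₀ + 1 / z₀‖
      rw [norm_zero, zero_mul] at h1
      refine h1.congr fun p => ?_
      have : ‖R z₀ + 1 / z₀‖ ≠ 0 := norm_ne_zero_iff.mpr hn₀
      simp only [q, FormalMultilinearSeries.ofScalars_norm, norm_div, norm_pow, coe_nnnorm,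
        norm_inv]
      rw [inv_pow, pow_succ]
      field_simp
    have := q.le_radius_of_tendsto hb
    refine lt_of_lt_of_le ?_ this
    simpa using hn₀
  have hq := (q.hasFPowerSeriesOnBall hrad).hasFPowerSeriesAt.analyticAt
  have hq0 : q.sum 0 = 1 := by
    have h1 : (q 0) (fun _ => (0 : ℂ)) = q.sum 0 :=
      (q.hasFPowerSeriesOnBall hrad).hasFPowerSeriesAt.coeff_zero _
    rw [← h1]
    simp [q, FormalMultilinearSeries.ofScalars, hν]
  let g : ℂ → ℂ := fun t => t * q.sum t
  have hg : HasStrictDerivAt g 1 0 := by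
    have h1 := (hasStrictDerivAt_id (0 : ℂ)).mul hq.hasStrictDerivAt
    rw [hq0] at h1
    simp only [id, zero_mul, mul_one, add_zero] at h1
    exact h1
  have hinj : ∀ᶠ t in 𝓝 (0 : ℂ), hg.localInverse g 1 0 one_ne_zero (g t) = t :=
    hg.eventually_left_inverse one_ne_zero
  have key : ∀ F : ℂ → ℂ, IsRTransform ν F → (∀ᶠ z in 𝓝[≠] (0 : ℂ), g (F z + 1 / z)⁻¹ = z) := by
    intro F hF
    filter_upwards [hF.hasCauchyTransform] with z hz
    have : HasSum (fun p : ℕ => (F z + 1 / z)⁻¹ * (ν (X ^ p) * (F z + 1 / z)⁻¹ ^ p)) z := by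
      have h1 : (fun p : ℕ => (F z + 1 / z)⁻¹ * (ν (X ^ p) * (F z + 1 / z)⁻¹ ^ p)) =
          fun p : ℕ => ν (X ^ p) / (F z + 1 / z) ^ (p + 1) := by
        funext p
        rw [div_eq_mul_inv (ν (X ^ p)), pow_succ, mul_inv, inv_pow]
        ring
      rw [h1]
      exact hz
    have h2 : g (F z + 1 / z)⁻¹ = ∑' p : ℕ, (F z + 1 / z)⁻¹ * (ν (X ^ p) * (F z + 1 / z)⁻¹ ^ p) := by
      rw [tsum_mul_left]
      simp only [g, q, FormalMultilinearSeries.sum, FormalMultilinearSeries.ofScalars_apply_eq,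
        smul_eq_mul]
    rw [h2, this.tsum_eq]
  refine (hR.analyticAt.frequently_eq_iff_eventually_eq hS.analyticAt).mp (Eventually.frequently ?_)
  filter_upwards [key R hR, key S hS, tR.eventually hinj, tS.eventually hinj] with z h1 h2 h3 h4
  rw [h1] at h3
  rw [h2] at h4
  have := inv_injective (h3.symm.trans h4)
  exact add_right_cancel this

/-- The distribution of an element of a `*`-noncommutative probability space is unital. -/
theorem distribution_one {A : Type*} [Ring A] [StarRing A] [Algebra ℂ A] [StarModule ℂ A]
    {τ : A →ₗ[ℂ] ℂ} (hτ : IsStarProbability τ) (a : A) : distribution τ a 1 = 1 := by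
  simp [distribution, hτ.map_one]

end

/-! Write `T_n T_n*` as the sum of `x x*` over the columns `x` of `T_n`, and add the columns one at
a time. Column `k` (counted from 0) has `k` free Gaussian entries and is independent of the Gram
matrix `W` of the earlier columns. The rank one update changes `tr W^a` by a universal polynomial
(`traceIncrement`) in the forms `q_b = x* W^b x`. Gaussian integration by parts replaces `q_b`,
inside expectations, by `(1/n) tr W^b` up to a correction of order `1/n`. Hence, with `t = k/n`, the
normalized traces should follow a flow `m_a'(t) = traceIncrement (m(t)) a` with `m_a(0) = 0`.

The homogeneous profile `m_a(t) = c_a t^(a+1)` solves this flow exactly when `traceIncrement c a =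
(a+1) c_a`. For `c_a = a^a/(a+1)!` this holds (`traceIncrement_treeMoment`). With `g(s) = ∑ c_a
s^(a+1)` it amounts to `(1 - g - s) g' = 1 - g`, and that equation follows from Abel's identity,
because the coefficients of `1 - g` are Abel polynomials evaluated at `-1`.

To make the flow rigorous for expectations of products, traces and forms become formal variables,
`tr a` and `form a` of weight `a + 1`. Both the correction from integration by parts and the
difference quotient in `k` lower the weight by one, so induction on the weight gives convergence at
rate `1/n`: each step is an Euler scheme whose `k ≤ n` increments have error `O(1/n²)`. Taking `k =
n`, that is `t = 1`, gives (a).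

For (b), `g(1/w)` is the Cauchy transform. The differential equation has the first integral `log(1 -
g) + s/(1 - g) = 0`, so the inverse of `g` at 0 is `z ↦ -(1 - z) log(1 - z)`. Its reciprocal minus
`1/z` is the R-transform. -/

/-! ### The Abel identity -/

/-- The Abel polynomial `x (x + n)^(n - 1)` divided by `n!`. -/
noncomputable def abelPoly : ℕ → ℂ → ℂ
  | 0, _ => 1
  | n + 1, x => x * (x + (n + 1)) ^ n / ((n + 1)! : ℂ)

theorem hasDerivAt_abelPoly_succ (n : ℕ) (x : ℂ) :
    HasDerivAt (abelPoly (n + 1)) (abelPoly n (x + 1)) x := by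
  have h : HasDerivAt (abelPoly (n + 1))
      ((1 * (x + (n + 1)) ^ n + x * (n * (x + (n + 1)) ^ (n - 1) * 1)) / ((n + 1)! : ℂ)) x :=
    ((hasDerivAt_id' x).mul (((hasDerivAt_id' x).add_const _).pow n)).div_const _
  convert h using 1
  cases n with
  | zero => simp [abelPoly]
  | succ m =>
    have h1 : ((m + 1)! : ℂ) ≠ 0 := by exact_mod_cast (m + 1).factorial_ne_zero
    have h2 : ((m : ℂ) + 1 + 1) ≠ 0 := by exact_mod_cast (m + 1).succ_ne_zero
    simp only [abelPoly, Nat.factorial_succ (m + 1)]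
    push_cast
    field_simp
    ring

/-- Induction on the degree: differentiation in `x` lowers the degree and translates the argument by
one, so by the induction hypothesis both sides have the same derivative. They agree at `x = 0`,
where every Abel polynomial of positive degree vanishes. -/
theorem abelPoly_add (n : ℕ) (x y : ℂ) :
    abelPoly n (x + y) = ∑ p ∈ Finset.HasAntidiagonal.antidiagonal n, abelPoly p.1 x * abelPoly p.2 y := by
  induction n generalizing x y with
  | zero => simp [abelPoly]
  | succ n ih =>
    let F : ℂ → ℂ := fun x => abelPoly (n + 1) (x + y) -
      (abelPoly 0 x * abelPoly (n + 1) y +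
        ∑ p ∈ Finset.HasAntidiagonal.antidiagonal n, abelPoly (p.1 + 1) x * abelPoly p.2 y)
    have hF : ∀ x, HasDerivAt F 0 x := by
      intro x
      have h1 : HasDerivAt (fun x => abelPoly (n + 1) (x + y)) (abelPoly n (x + y + 1)) x :=
        (hasDerivAt_abelPoly_succ n (x + y)).comp_add_const x y
      have h2 : HasDerivAt (fun x => abelPoly 0 x * abelPoly (n + 1) y +
          ∑ p ∈ Finset.HasAntidiagonal.antidiagonal n, abelPoly (p.1 + 1) x * abelPoly p.2 y)
          (∑ p ∈ Finset.HasAntidiagonal.antidiagonal n, abelPoly p.1 (x + 1) * abelPoly p.2 y) x :=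
        (HasDerivAt.fun_sum fun (p : ℕ × ℕ) _ =>
          (hasDerivAt_abelPoly_succ p.1 x).mul_const (abelPoly p.2 y)).const_add
            (1 * abelPoly (n + 1) y)
      have h3 := h1.sub h2
      rwa [← ih, add_right_comm, sub_self] at h3
    have hc := is_const_of_deriv_eq_zero (fun x => (hF x).differentiableAt)
      (fun x => (hF x).deriv) x 0
    have h0 : F 0 = 0 := by
      simp [F, abelPoly]
    rw [Finset.Nat.sum_antidiagonal_succ]
    exact sub_eq_zero.mp (hc.trans h0)

/-! ### The moment sequence `p ^ p / (p + 1)!` -/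

/-- The sequence `p ^ p / (p + 1)!`. -/
noncomputable def treeMoment (p : ℕ) : ℂ := (p : ℂ) ^ p / ((p + 1)! : ℂ)

/-- The generating series `∑ p ^ p / (p + 1)! X ^ (p + 1)`. -/
noncomputable def treeSeries : PowerSeries ℂ := PowerSeries.X * PowerSeries.mk treeMoment

theorem one_sub_treeSeries : 1 - treeSeries = PowerSeries.mk fun n => abelPoly n (-1) := by
  ext n
  cases n with
  | zero => simp [treeSeries, abelPoly]
  | succ n => simp [treeSeries, abelPoly, treeMoment, PowerSeries.coeff_succ_X_mul,
      PowerSeries.coeff_one, neg_div]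

/-- With `h = 1 - g`, Abel's identity at `-1 + -1` puts `h²` in closed form. Comparing coefficients
then gives `(h²)' + 2h = 2X h'`, which is twice the claim since `g' = -h'`. -/
theorem treeSeries_ode :
    (1 - treeSeries - PowerSeries.X) * PowerSeries.derivative ℂ treeSeries = 1 - treeSeries := by
  have hsq : (1 - treeSeries) * (1 - treeSeries) = PowerSeries.mk fun n => abelPoly n (-2) := by
    rw [one_sub_treeSeries]
    ext n
    rw [PowerSeries.coeff_mul, PowerSeries.coeff_mk, show (-2 : ℂ) = -1 + -1 by norm_num,
      abelPoly_add]
    simp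
  have hg : PowerSeries.derivative ℂ treeSeries = - PowerSeries.derivative ℂ (1 - treeSeries) := by
    simp [map_sub]
  have hd : PowerSeries.derivative ℂ ((1 - treeSeries) * (1 - treeSeries)) =
      2 * ((1 - treeSeries) * PowerSeries.derivative ℂ (1 - treeSeries)) := by
    rw [Derivation.leibniz]; simp only [smul_eq_mul]; ring
  have key : PowerSeries.derivative ℂ ((1 - treeSeries) * (1 - treeSeries)) +
      2 * (1 - treeSeries) = 2 * (PowerSeries.X * PowerSeries.derivative ℂ (1 - treeSeries)) := by
    rw [hsq, one_sub_treeSeries]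
    ext n
    rw [map_add, PowerSeries.coeff_derivative, PowerSeries.coeff_mk,
      show (2 : PowerSeries ℂ) = PowerSeries.C 2 from (map_ofNat _ 2).symm,
      PowerSeries.coeff_C_mul, PowerSeries.coeff_C_mul, PowerSeries.coeff_mk]
    cases n with
    | zero => simp [abelPoly]
    | succ m =>
      rw [PowerSeries.coeff_succ_X_mul, PowerSeries.coeff_derivative, PowerSeries.coeff_mk]
      have h1 : ((m + 1)! : ℂ) ≠ 0 := by exact_mod_cast (m + 1).factorial_ne_zero
      have h2 : ((m : ℂ) + 1 + 1) ≠ 0 := by exact_mod_cast (m + 1).succ_ne_zero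
      simp only [abelPoly, Nat.factorial_succ (m + 1)]
      push_cast
      field_simp
      ring
  have h2 : (2 : PowerSeries ℂ) ≠ 0 := by
    intro h
    have := congrArg PowerSeries.constantCoeff h
    rw [map_ofNat, map_zero] at this
    exact two_ne_zero this
  apply mul_left_cancel₀ h2
  rw [hg]
  linear_combination hd - key

/-! ### Power traces under rank one perturbations -/

section Recursion

variable {S S' : Type*} [CommRing S] [CommRing S']

/-- If `q i = x* W^i x`, then `perturbedForm q i = x* (W + x x*)^i x`. -/
def perturbedForm (q : ℕ → S) (i : ℕ) : S :=
  q i + ∑ l : Fin i, q (i - 1 - l) * perturbedForm q l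
termination_by i
decreasing_by exact l.2

/-- If `q i = x* W^i x`, then `traceIncrement q p = tr (W + x x*)^p - tr W^p` for `p ≥ 1`. -/
def traceIncrement (q : ℕ → S) : ℕ → S
  | 0 => 1
  | p + 1 => (p + 1) * q p + ∑ l ∈ Finset.range p, ((p - l : ℕ) : S) * q (p - 1 - l) * perturbedForm q l

theorem perturbedForm_eq (q : ℕ → S) (i : ℕ) :
    perturbedForm q i = q i + ∑ l ∈ Finset.range i, q (i - 1 - l) * perturbedForm q l := by
  rw [perturbedForm, Finset.sum_range]

theorem map_perturbedForm {F : Type*} [FunLike F S S'] [RingHomClass F S S'] (f : F) (q : ℕ → S) (i : ℕ) :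
    f (perturbedForm q i) = perturbedForm (fun j => f (q j)) i := by
  induction i using Nat.strong_induction_on with
  | _ i ih =>
    rw [perturbedForm_eq, perturbedForm_eq, map_add, map_sum]
    congr 1
    refine Finset.sum_congr rfl fun l hl => ?_
    rw [map_mul, ih l (Finset.mem_range.mp hl)]

theorem map_traceIncrement {F : Type*} [FunLike F S S'] [RingHomClass F S S'] (f : F) (q : ℕ → S) (p : ℕ) :
    f (traceIncrement q p) = traceIncrement (fun j => f (q j)) p := by
  cases p with
  | zero => simp [traceIncrement]
  | succ p => simp [traceIncrement, map_perturbedForm]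

theorem perturbedForm_scale (q : ℕ → S) (t : S) (i : ℕ) :
    perturbedForm (fun b => q b * t ^ (b + 1)) i = perturbedForm q i * t ^ (i + 1) := by
  induction i using Nat.strong_induction_on with
  | _ i ih =>
    rw [perturbedForm_eq, perturbedForm_eq, add_mul, Finset.sum_mul]
    congr 1
    refine Finset.sum_congr rfl fun l hl => ?_
    have hl := Finset.mem_range.mp hl
    rw [ih l hl, show i + 1 = (i - 1 - l + 1) + (l + 1) by omega, pow_add]
    ring

/-- Homogeneity: if `q b` has degree `b + 1`, the increment at `p` has degree `p`. This separates
the powers of `t` from the constants in the limiting flow. -/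
theorem traceIncrement_scale (q : ℕ → S) (t : S) (p : ℕ) :
    traceIncrement (fun b => q b * t ^ (b + 1)) p = traceIncrement q p * t ^ p := by
  cases p with
  | zero => simp [traceIncrement]
  | succ p =>
    simp only [traceIncrement, perturbedForm_scale]
    rw [add_mul (_ * _), Finset.sum_mul]
    congr 1
    · ring
    refine Finset.sum_congr rfl fun l hl => ?_
    have hl := Finset.mem_range.mp hl
    rw [show p + 1 = (p - 1 - l + 1) + (l + 1) by omega, pow_add t (p - 1 - l + 1)]
    ring

/-- The recursion is a geometric series: with `Q` the series of `q` and `P` that of the perturbed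
forms, `1 + X P = 1/(1 - X Q)`. -/
theorem mk_perturbedForm (q : ℕ → S) :
    PowerSeries.mk (perturbedForm q) =
      PowerSeries.mk q + PowerSeries.X * (PowerSeries.mk q * PowerSeries.mk (perturbedForm q)) := by
  ext n
  cases n with
  | zero => simp [perturbedForm_eq q 0]
  | succ n =>
    rw [map_add, PowerSeries.coeff_succ_X_mul, PowerSeries.coeff_mul, PowerSeries.coeff_mk,
      PowerSeries.coeff_mk, perturbedForm_eq, ← Finset.Nat.sum_antidiagonal_swap,
      Finset.Nat.sum_antidiagonal_eq_sum_range_succ_mk]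
    simp

/-- With `g = X Q` this reads `1 + X g'/(1 - g)`, where the quotient is minus the logarithmic
derivative of `1 - g`, as in the matrix determinant lemma. -/
theorem mk_traceIncrement (q : ℕ → S) :
    PowerSeries.mk (traceIncrement q) =
      1 + PowerSeries.X * (PowerSeries.derivative S (PowerSeries.X * PowerSeries.mk q) *
        (1 + PowerSeries.X * PowerSeries.mk (perturbedForm q))) := by
  ext n
  cases n with
  | zero => simp [traceIncrement]
  | succ n =>
    rw [map_add, PowerSeries.coeff_succ_X_mul, mul_add, mul_one, map_add,
      PowerSeries.coeff_derivative, PowerSeries.coeff_mk, PowerSeries.coeff_succ_X_mul,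
      mul_left_comm, PowerSeries.coeff_mk]
    simp only [traceIncrement]
    cases n with
    | zero => simp [PowerSeries.coeff_one]
    | succ n =>
      rw [PowerSeries.coeff_succ_X_mul, PowerSeries.coeff_mul, ← Finset.Nat.sum_antidiagonal_swap,
        Finset.Nat.sum_antidiagonal_eq_sum_range_succ_mk, PowerSeries.coeff_one]
      simp only [Nat.add_eq_zero_iff, one_ne_zero, and_false, if_false, zero_add, Prod.fst_swap,
        Prod.snd_swap, PowerSeries.coeff_mk, PowerSeries.coeff_derivative,
        PowerSeries.coeff_succ_X_mul, Nat.add_sub_cancel]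
      congr 1
      · push_cast; ring
      refine Finset.sum_congr rfl fun l hl => ?_
      have hl := Finset.mem_range.mp hl
      rw [show n + 1 - l = n - l + 1 by omega]
      push_cast
      ring

end Recursion

/-- The equation that singles out the moments: in generating functions it says `1 + X g'/(1 - g) =
g'`, a rearrangement of `treeSeries_ode`. -/
theorem traceIncrement_treeMoment (p : ℕ) :
    traceIncrement treeMoment p = (p + 1) * treeMoment p := by
  have h1 := mk_perturbedForm treeMoment
  have h2 := mk_traceIncrement treeMoment
  have h3 := treeSeries_ode
  rw [← treeSeries] at h2
  have hne : (1 - treeSeries) ≠ 0 := by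
    intro h
    have := congrArg (PowerSeries.coeff 0) h
    simp [treeSeries] at this
  have h4 : (1 - treeSeries) * (1 + PowerSeries.X * PowerSeries.mk (perturbedForm treeMoment)) =
      1 := by
    rw [treeSeries]
    linear_combination PowerSeries.X * h1
  have key : PowerSeries.mk (traceIncrement treeMoment) = PowerSeries.derivative ℂ treeSeries := by
    apply mul_left_cancel₀ hne
    rw [h2]
    linear_combination PowerSeries.X * PowerSeries.derivative ℂ treeSeries * h4 - h3
  have := congrArg (PowerSeries.coeff p) key
  rw [PowerSeries.coeff_derivative, treeSeries, PowerSeries.coeff_succ_X_mul, PowerSeries.coeff_mk,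
    PowerSeries.coeff_mk] at this
  rw [this, mul_comm]

/-! ### The R-transform of the sequence `p ^ p / (p + 1)!` -/

/-- The formal power series `f` converges absolutely at `s`, with sum `a`. -/
def HasPowerSeriesSum (f : PowerSeries ℂ) (s a : ℂ) : Prop :=
  Summable (fun n => ‖PowerSeries.coeff n f * s ^ n‖) ∧ ∑' n, PowerSeries.coeff n f * s ^ n = a

/-! ### Evaluation of formal power series respects ring operations -/

namespace HasPowerSeriesSum

variable {f g : PowerSeries ℂ} {s a b : ℂ}

theorem one : HasPowerSeriesSum 1 s 1 := by
  have h : ∀ n ∉ ({0} : Finset ℕ), PowerSeries.coeff n (1 : PowerSeries ℂ) * s ^ n = 0 := by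
    intro n hn
    simp [PowerSeries.coeff_one, Finset.mem_singleton.not.mp hn]
  exact ⟨(summable_of_ne_finset_zero h).norm, by rw [tsum_eq_sum h]; simp⟩

theorem X : HasPowerSeriesSum PowerSeries.X s s := by
  have h : ∀ n ∉ ({1} : Finset ℕ),
      PowerSeries.coeff n (PowerSeries.X : PowerSeries ℂ) * s ^ n = 0 := by
    intro n hn
    simp [PowerSeries.coeff_X, Finset.mem_singleton.not.mp hn]
  exact ⟨(summable_of_ne_finset_zero h).norm, by rw [tsum_eq_sum h]; simp⟩

theorem sub (hf : HasPowerSeriesSum f s a) (hg : HasPowerSeriesSum g s b) :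
    HasPowerSeriesSum (f - g) s (a - b) := by
  refine ⟨?_, ?_⟩
  · simp only [map_sub, sub_mul]
    exact (hf.1.of_norm.sub hg.1.of_norm).norm
  · simp only [map_sub, sub_mul]
    rw [hf.1.of_norm.tsum_sub hg.1.of_norm, hf.2, hg.2]

theorem mul (hf : HasPowerSeriesSum f s a) (hg : HasPowerSeriesSum g s b) :
    HasPowerSeriesSum (f * g) s (a * b) := by
  have h : ∀ n, PowerSeries.coeff n (f * g) * s ^ n =
      ∑ p ∈ Finset.HasAntidiagonal.antidiagonal n,
        (PowerSeries.coeff p.1 f * s ^ p.1) * (PowerSeries.coeff p.2 g * s ^ p.2) := by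
    intro n
    rw [PowerSeries.coeff_mul, Finset.sum_mul]
    refine Finset.sum_congr rfl fun p hp => ?_
    rw [← Finset.HasAntidiagonal.mem_antidiagonal.mp hp, pow_add]
    ring
  refine ⟨?_, ?_⟩
  · simp only [h]
    exact summable_norm_sum_mul_antidiagonal_of_summable_norm
      (f := fun n => PowerSeries.coeff n f * s ^ n) (g := fun n => PowerSeries.coeff n g * s ^ n)
      hf.1 hg.1
  · simp only [h]
    exact (tsum_mul_tsum_eq_tsum_sum_antidiagonal_of_summable_norm
      (f := fun n => PowerSeries.coeff n f * s ^ n) (g := fun n => PowerSeries.coeff n g * s ^ n)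
      hf.1 hg.1).symm.trans (by rw [hf.2, hg.2])

end HasPowerSeriesSum

/-- Since `p^p/p! ≤ e^p ≤ 3^p`, the series for `g` and `g'` are dominated by a geometric series of
ratio `3/4` on `‖s‖ ≤ 1/4`. -/
theorem norm_succ_mul_treeMoment_le (p : ℕ) : ‖((p : ℂ) + 1) * treeMoment p‖ ≤ 3 ^ p := by
  have h1 : ((p : ℂ) + 1) * treeMoment p = (((p : ℝ) ^ p / (p ! : ℝ) : ℝ) : ℂ) := by
    have h1 : (p ! : ℂ) ≠ 0 := by exact_mod_cast p.factorial_ne_zero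
    have h2 : ((p : ℂ) + 1) ≠ 0 := by exact_mod_cast p.succ_ne_zero
    rw [treeMoment, Nat.factorial_succ]
    push_cast
    field_simp
  rw [h1, Complex.norm_real, Real.norm_of_nonneg (by positivity)]
  calc (p : ℝ) ^ p / (p ! : ℝ) ≤ Real.exp p := Real.pow_div_factorial_le_exp _ (by positivity) _
    _ = Real.exp 1 ^ p := by rw [← Real.exp_nat_mul, mul_one]
    _ ≤ 3 ^ p := by gcongr; exact Real.exp_one_lt_three.le

theorem norm_treeMoment_le (p : ℕ) : ‖treeMoment p‖ ≤ 3 ^ p := by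
  refine le_trans ?_ (norm_succ_mul_treeMoment_le p)
  rw [norm_mul]
  refine le_mul_of_one_le_left (norm_nonneg _) ?_
  rw [show ((p : ℂ) + 1) = ((p + 1 : ℕ) : ℂ) by push_cast; rfl, Complex.norm_natCast]
  simp

theorem norm_mul_pow_le {c s : ℂ} {p : ℕ} (hc : ‖c‖ ≤ 3 ^ p) (hs : ‖s‖ ≤ 1 / 4) :
    ‖c * s ^ p‖ ≤ (3 / 4 : ℝ) ^ p := by
  rw [norm_mul, norm_pow, show (3 / 4 : ℝ) = 3 * (1 / 4) by norm_num, mul_pow]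
  gcongr

theorem summable_three_quarters_pow : Summable fun p : ℕ => (3 / 4 : ℝ) ^ p :=
  summable_geometric_of_lt_one (by norm_num) (by norm_num)

/-- The sum `∑ p ^ p / (p + 1)! s ^ (p + 1)`: the Cauchy transform at `1 / s`. -/
noncomputable def treeFun (s : ℂ) : ℂ := ∑' p, treeMoment p * s ^ (p + 1)

/-- The derivative of `treeFun`. -/
noncomputable def treeFunDeriv (s : ℂ) : ℂ := ∑' p : ℕ, ((p : ℂ) + 1) * treeMoment p * s ^ p

theorem summable_treeMoment {s : ℂ} (hs : ‖s‖ ≤ 1 / 4) :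
    Summable fun p => ‖treeMoment p * s ^ p‖ :=
  .of_nonneg_of_le (fun _ => norm_nonneg _) (fun p => norm_mul_pow_le (norm_treeMoment_le p) hs)
    summable_three_quarters_pow

theorem hasSum_treeFun {s : ℂ} (hs : ‖s‖ ≤ 1 / 4) :
    HasSum (fun p => treeMoment p * s ^ (p + 1)) (treeFun s) := by
  refine Summable.hasSum ?_
  simp only [pow_succ, ← mul_assoc]
  exact (summable_treeMoment hs).of_norm.mul_right s

theorem treeFun_zero : treeFun 0 = 0 := by simp [treeFun]

theorem hasDerivAt_treeFun {s : ℂ} (hs : ‖s‖ < 1 / 4) :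
    HasDerivAt treeFun (treeFunDeriv s) s := by
  refine hasDerivAt_tsum_of_isPreconnected (t := Metric.ball 0 (1 / 4)) (y₀ := 0)
    (g := fun p s => treeMoment p * s ^ (p + 1))
    (g' := fun p s => ((p : ℂ) + 1) * treeMoment p * s ^ p)
    summable_three_quarters_pow Metric.isOpen_ball (convex_ball _ _).isPreconnected ?_ ?_ ?_ ?_ ?_
  · intro p y _
    have h := (((hasDerivAt_id' y).pow (p + 1)).const_mul (treeMoment p))
    refine h.congr_deriv ?_
    simp
    ring
  · intro p y hy
    exact norm_mul_pow_le (norm_succ_mul_treeMoment_le p) (by simpa using (mem_ball_zero_iff.mp hy).le)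
  · simp
  · simp
  · simpa using hs

theorem hasPowerSeriesSum_treeSeries {s : ℂ} (hs : ‖s‖ < 1 / 4) :
    HasPowerSeriesSum treeSeries s (treeFun s) := by
  have h : HasPowerSeriesSum (PowerSeries.mk treeMoment) s (∑' p, treeMoment p * s ^ p) := by
    simp only [HasPowerSeriesSum, PowerSeries.coeff_mk, and_true]
    exact summable_treeMoment hs.le
  have h2 := HasPowerSeriesSum.X.mul h
  rw [← tsum_mul_left] at h2
  have e : treeFun s = ∑' p, s * (treeMoment p * s ^ p) :=
    tsum_congr fun p => by ring
  rw [e]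
  exact h2

theorem hasPowerSeriesSum_derivative_treeSeries {s : ℂ} (hs : ‖s‖ < 1 / 4) :
    HasPowerSeriesSum (PowerSeries.derivative ℂ treeSeries) s (treeFunDeriv s) := by
  have h : ∀ p, PowerSeries.coeff p (PowerSeries.derivative ℂ treeSeries) =
      ((p : ℂ) + 1) * treeMoment p := by
    intro p
    rw [PowerSeries.coeff_derivative, treeSeries, PowerSeries.coeff_succ_X_mul,
      PowerSeries.coeff_mk, mul_comm]
  simp only [HasPowerSeriesSum, h]
  exact ⟨.of_nonneg_of_le (fun _ => norm_nonneg _)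
    (fun p => norm_mul_pow_le (norm_succ_mul_treeMoment_le p) hs.le)
    summable_three_quarters_pow, rfl⟩

theorem treeFun_ode {s : ℂ} (hs : ‖s‖ < 1 / 4) :
    (1 - treeFun s - s) * treeFunDeriv s = 1 - treeFun s := by
  have h1 := hasPowerSeriesSum_treeSeries hs
  have h2 := HasPowerSeriesSum.one.sub h1
  have h3 := (h2.sub HasPowerSeriesSum.X).mul (hasPowerSeriesSum_derivative_treeSeries hs)
  rw [treeSeries_ode] at h3
  exact h3.2.symm.trans h2.2

/-- The local inverse `z ↦ -(1 - z) log (1 - z)` of `treeFun`. -/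
noncomputable def treeInv (z : ℂ) : ℂ := -(1 - z) * Complex.log (1 - z)

theorem treeInv_zero : treeInv 0 = 0 := by simp [treeInv]

theorem hasStrictDerivAt_treeInv : HasStrictDerivAt treeInv 1 0 := by
  have h1 : HasStrictDerivAt (fun z : ℂ => 1 - z) (-1) 0 := (hasStrictDerivAt_id _).const_sub 1
  have h2 : HasStrictDerivAt treeInv _ 0 := h1.neg.mul (h1.clog (by simp))
  simpa using h2

theorem analyticAt_treeInv : AnalyticAt ℂ treeInv 0 := by
  have h1 : AnalyticAt ℂ (fun z : ℂ => 1 - z) 0 := by fun_prop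
  exact h1.neg.mul (h1.clog (by simp))

theorem continuousAt_treeFun : ContinuousAt treeFun 0 :=
  (hasDerivAt_treeFun (by simp)).continuousAt

theorem treeInv_treeFun : ∀ᶠ s in 𝓝 (0 : ℂ), treeInv (treeFun s) = s := by
  have h0 : ContinuousAt (fun s => 1 - treeFun s) 0 := continuousAt_const.sub continuousAt_treeFun
  have h1 : ∀ᶠ s in 𝓝 (0 : ℂ), 1 - treeFun s ∈ Complex.slitPlane :=
    h0.eventually_mem (Complex.isOpen_slitPlane.mem_nhds (by simp [treeFun_zero]))
  have h2 : ∀ᶠ s in 𝓝 (0 : ℂ), ‖s‖ < 1 / 4 := by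
    filter_upwards [Metric.ball_mem_nhds (0 : ℂ) (by norm_num : (0 : ℝ) < 1 / 4)] with s hs
    simpa using hs
  obtain ⟨ε, hε, hball⟩ := Metric.eventually_nhds_iff_ball.mp (h1.and h2)
  -- First integral of `treeFun_ode`: its derivative is `((1 - g) - (1 - g - s) g')/(1 - g)²`.
  let H : ℂ → ℂ := fun s => Complex.log (1 - treeFun s) + s / (1 - treeFun s)
  have hH : ∀ s ∈ Metric.ball (0 : ℂ) ε, HasDerivAt H 0 s := by
    intro s hs
    obtain ⟨hs1, hs2⟩ := hball s hs
    have hne := Complex.slitPlane_ne_zero hs1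
    have hg : HasDerivAt (fun s => 1 - treeFun s) (-treeFunDeriv s) s :=
      (hasDerivAt_treeFun hs2).const_sub 1
    refine ((hg.clog hs1).add ((hasDerivAt_id' s).div hg hne)).congr_deriv ?_
    have := treeFun_ode hs2
    field_simp
    linear_combination -this
  have hconst : ∀ s ∈ Metric.ball (0 : ℂ) ε, H s = 0 := by
    intro s hs
    have := Metric.isOpen_ball.is_const_of_deriv_eq_zero (convex_ball (0 : ℂ) ε).isPreconnected
      (fun x hx => (hH x hx).differentiableAt.differentiableWithinAt)
      (fun x hx => (hH x hx).deriv) hs (Metric.mem_ball_self hε)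
    rw [this]
    simp [H, treeFun_zero]
  filter_upwards [Metric.ball_mem_nhds (0 : ℂ) hε] with s hs
  have hne := Complex.slitPlane_ne_zero (hball s hs).1
  have := hconst s hs
  simp only [H] at this
  field_simp at this
  rw [treeInv]
  linear_combination -this

/-- A one-sided inverse suffices: `treeInv` has derivative 1 at 0, so it is injective there and can
be cancelled from `treeInv (treeFun (treeInv z)) = treeInv z`. -/
theorem treeFun_treeInv : ∀ᶠ z in 𝓝 (0 : ℂ), treeFun (treeInv z) = z := by
  have hinj := hasStrictDerivAt_treeInv.eventually_left_inverse one_ne_zero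
  have h1 : Tendsto treeInv (𝓝 0) (𝓝 0) := by
    simpa [treeInv_zero] using hasStrictDerivAt_treeInv.hasDerivAt.continuousAt.tendsto
  have h2 : Tendsto treeFun (𝓝 0) (𝓝 0) := by
    simpa [treeFun_zero] using continuousAt_treeFun.tendsto
  filter_upwards [hinj, (h2.comp h1).eventually hinj, h1.eventually treeInv_treeFun] with z a b c
  simp only [Function.comp] at b
  rw [c, a] at b
  exact b.symm

theorem exists_isRTransform {ν : ℂ[X] →ₗ[ℂ] ℂ} (hν : ∀ p, ν (X ^ p) = treeMoment p) :
    ∃ R : ℂ → ℂ, IsRTransform ν R ∧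
      ∀ᶠ z in 𝓝[≠] (0 : ℂ), R z = -1 / ((1 - z) * Complex.log (1 - z)) - 1 / z := by
  have dslope_analytic : ∀ {f : ℂ → ℂ}, AnalyticAt ℂ f 0 → AnalyticAt ℂ (dslope f 0) 0 := by
    rintro f ⟨p, hp⟩
    exact ⟨_, hp.has_fpower_series_dslope_fslope⟩
  let u : ℂ → ℂ := dslope treeInv 0
  have hu : AnalyticAt ℂ u 0 := dslope_analytic analyticAt_treeInv
  have hu0 : u 0 = 1 := by
    simp only [u, dslope_same]
    exact hasStrictDerivAt_treeInv.hasDerivAt.deriv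
  have hune : ∀ᶠ z in 𝓝[≠] (0 : ℂ), u z ≠ 0 :=
    (hu.continuousAt.eventually_ne (by simp [hu0])).filter_mono nhdsWithin_le_nhds
  have hzne : ∀ᶠ z in 𝓝[≠] (0 : ℂ), z ≠ 0 := self_mem_nhdsWithin
  have hmul : ∀ z, treeInv z = z * u z := by
    intro z
    have := sub_smul_dslope treeInv 0 z
    simpa [treeInv_zero] using this.symm
  -- From `treeInv z = z u(z)` with `u 0 = 1`, the difference `1/treeInv z - 1/z` is `-((u -
  -- 1)/z)/u`. Writing it with `dslope` removes the singularity at 0.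
  let R : ℂ → ℂ := fun z => -dslope u 0 z / u z
  have hR : ∀ᶠ z in 𝓝[≠] (0 : ℂ), R z + 1 / z = 1 / treeInv z := by
    filter_upwards [hune, hzne] with z h1 h2
    have h3 : z * dslope u 0 z = u z - 1 := by
      have := sub_smul_dslope u 0 z
      simpa [hu0] using this
    simp only [R, hmul]
    field_simp
    linear_combination -h3
  refine ⟨R, ⟨(dslope_analytic hu).neg.div hu (by simp [hu0]), ?_⟩, ?_⟩
  · have hsmall : ∀ᶠ z in 𝓝 (0 : ℂ), ‖treeInv z‖ < 1 / 4 := by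
      have := hasStrictDerivAt_treeInv.hasDerivAt.continuousAt.norm
      refine this.eventually_lt continuousAt_const (by simp [treeInv_zero])
    filter_upwards [hR, treeFun_treeInv.filter_mono nhdsWithin_le_nhds,
      hsmall.filter_mono nhdsWithin_le_nhds] with z h1 h2 h3
    have := hasSum_treeFun h3.le
    rw [h2] at this
    rw [HasCauchyTransform, h1]
    simpa [hν, div_eq_mul_inv] using this
  · filter_upwards [hR] with z hz
    rw [eq_sub_iff_add_eq, hz, treeInv, neg_mul, one_div, neg_div, one_div, inv_neg]

/-! ### Gaussian integration by parts -/

theorem integrable_eval_gaussianReal (s : ℝ≥0) (p : ℂ[X]) :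
    Integrable (fun x : ℝ => p.eval (x : ℂ)) (gaussianReal 0 s) := by
  have h : ∀ k : ℕ, Integrable (fun x : ℝ => (x : ℂ) ^ k) (gaussianReal 0 s) := by
    intro k
    have h1 : MemLp id (k : ENNReal) (gaussianReal 0 s) := memLp_id_gaussianReal' k (by simp)
    have h2 : Integrable (fun x : ℝ => ((x ^ k : ℝ) : ℂ)) (gaussianReal 0 s) := by
      have h3 : Integrable (fun x : ℝ => x ^ k) (gaussianReal 0 s) := by
        rw [← integrable_norm_iff (by fun_prop)]
        simpa using h1.integrable_norm_pow'
      exact h3.ofReal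
    simpa using h2
  simp only [Polynomial.eval_eq_sum_range]
  exact integrable_finsetSum _ fun i _ => (h i).const_mul _

theorem hasDerivAt_gaussianPDFReal {s : ℝ≥0} (hs : s ≠ 0) (x : ℝ) :
    HasDerivAt (gaussianPDFReal 0 s) (-(x / s) * gaussianPDFReal 0 s x) x := by
  have hs' : (s : ℝ) ≠ 0 := by exact_mod_cast hs
  have h : HasDerivAt (gaussianPDFReal 0 s)
      ((√(2 * Real.pi * s))⁻¹ * (Real.exp (-(x - 0) ^ 2 / (2 * s)) *
        (-(2 * (x - 0) ^ 1 * 1) / (2 * s)))) x :=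
    ((((((hasDerivAt_id' x).sub_const 0).pow 2).neg).div_const _).exp).const_mul _
  convert h using 1
  simp only [gaussianPDFReal]
  field_simp
  ring

theorem integrable_gaussianPDFReal_smul_eval {s : ℝ≥0} (hs : s ≠ 0) (p : ℂ[X]) :
    Integrable (fun x : ℝ => p.eval (x : ℂ) * (gaussianPDFReal 0 s x : ℂ)) := by
  have h := integrable_eval_gaussianReal s p
  rw [gaussianReal_of_var_ne_zero _ hs, integrable_withDensity_iff_integrable_smul'
    (measurable_gaussianPDF 0 s) (by simp [gaussianPDF])] at h
  refine h.congr (ae_of_all _ fun x => ?_)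
  simp [gaussianPDF, gaussianPDFReal_nonneg, mul_comm]

/-- Stein's identity for polynomials. -/
theorem integral_mul_eval_gaussianReal {s : ℝ≥0} (hs : s ≠ 0) (p : ℂ[X]) :
    ∫ x : ℝ, (x : ℂ) * p.eval (x : ℂ) ∂(gaussianReal 0 s) =
      s * ∫ x : ℝ, p.derivative.eval (x : ℂ) ∂(gaussianReal 0 s) := by
  have hs' : (s : ℂ) ≠ 0 := by exact_mod_cast hs
  have key := integral_mul_deriv_eq_deriv_mul_of_integrable
    (u := fun x : ℝ => p.eval (x : ℂ)) (u' := fun x : ℝ => p.derivative.eval (x : ℂ))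
    (v := fun x : ℝ => (gaussianPDFReal 0 s x : ℂ))
    (v' := fun x : ℝ => ((-(x / s) * gaussianPDFReal 0 s x : ℝ) : ℂ))
    (fun x _ => (p.hasDerivAt (x : ℂ)).comp_ofReal)
    (fun x _ => (hasDerivAt_gaussianPDFReal hs x).ofReal_comp)
    (by
      have := (integrable_gaussianPDFReal_smul_eval hs (X * p)).const_mul (-(1 / s : ℂ))
      refine this.congr (ae_of_all _ fun x => ?_)
      simp
      ring)
    (integrable_gaussianPDFReal_smul_eval hs _) (integrable_gaussianPDFReal_smul_eval hs _)
  rw [integral_gaussianReal_eq_integral_smul hs, integral_gaussianReal_eq_integral_smul hs]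
  have h1 : ∫ x : ℝ, gaussianPDFReal 0 s x • p.derivative.eval (x : ℂ) =
      ∫ x : ℝ, p.derivative.eval (x : ℂ) * (gaussianPDFReal 0 s x : ℂ) := by
    congr 1; funext x; rw [Complex.real_smul, mul_comm]
  have h2 : ∫ x : ℝ, gaussianPDFReal 0 s x • ((x : ℂ) * p.eval (x : ℂ)) =
      -s * ∫ x : ℝ, p.eval (x : ℂ) * ((-(x / s) * gaussianPDFReal 0 s x : ℝ) : ℂ) := by
    rw [← integral_const_mul]
    congr 1; funext x; rw [Complex.real_smul]; push_cast; field_simp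
  rw [h1, h2, key]
  ring

/-- Integration of bivariate polynomials against two independent real Gaussians. -/
theorem integrable_eval_gaussianReal_prod (s : ℝ≥0) (P : MvPolynomial Bool ℂ) :
    Integrable (fun z : ℝ × ℝ => P.eval (fun b => bif b then (z.1 : ℂ) else z.2))
      ((gaussianReal 0 s).prod (gaussianReal 0 s)) := by
  induction P using MvPolynomial.induction_on' with
  | monomial m c =>
    have h := (integrable_eval_gaussianReal s (X ^ m true)).mul_prod
      (integrable_eval_gaussianReal s (X ^ m false))
    refine (h.const_mul c).congr (ae_of_all _ fun z => ?_)
    simp [MvPolynomial.eval_monomial, Finsupp.prod_fintype]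
  | add p q hp hq => simp only [map_add]; exact hp.add hq

theorem integral_mul_eval_gaussianReal_prod {s : ℝ≥0} (hs : s ≠ 0) (i : Bool)
    (P : MvPolynomial Bool ℂ) :
    ∫ z : ℝ × ℝ, (MvPolynomial.X i * P).eval (fun b => bif b then (z.1 : ℂ) else z.2)
      ∂((gaussianReal 0 s).prod (gaussianReal 0 s)) =
    s * ∫ z : ℝ × ℝ, (MvPolynomial.pderiv i P).eval (fun b => bif b then (z.1 : ℂ) else z.2)
      ∂((gaussianReal 0 s).prod (gaussianReal 0 s)) := by
  induction P using MvPolynomial.induction_on' with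
  | monomial m c =>
    have e1 : ∀ k : ℕ, ∫ x : ℝ, (x : ℂ) * (x : ℂ) ^ k ∂(gaussianReal 0 s) =
        s * (k * ∫ x : ℝ, (x : ℂ) ^ (k - 1) ∂(gaussianReal 0 s)) := by
      intro k
      have := integral_mul_eval_gaussianReal hs (X ^ k : ℂ[X])
      simpa [Polynomial.derivative_X_pow, integral_const_mul] using this
    have e2 : ∀ (a b : ℕ), ∫ z : ℝ × ℝ, (z.1 : ℂ) ^ a * (z.2 : ℂ) ^ b
        ∂((gaussianReal 0 s).prod (gaussianReal 0 s)) =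
        (∫ x : ℝ, (x : ℂ) ^ a ∂(gaussianReal 0 s)) * ∫ x : ℝ, (x : ℂ) ^ b ∂(gaussianReal 0 s) :=
      fun a b => integral_prod_mul (fun x : ℝ => (x : ℂ) ^ a) (fun x : ℝ => (x : ℂ) ^ b)
    simp only [← pow_succ'] at e1
    rw [MvPolynomial.X, MvPolynomial.monomial_mul, one_mul, MvPolynomial.pderiv_monomial]
    simp only [MvPolynomial.eval_monomial, Finsupp.prod_fintype, pow_zero, implies_true,
      Fintype.prod_bool, cond_true, cond_false, integral_const_mul, e2]
    cases i
    · simp [e1, add_comm 1]; ring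
    · simp [e1, add_comm 1]; ring
  | add p q hp hq =>
    simp only [mul_add, map_add]
    rw [integral_add (integrable_eval_gaussianReal_prod s _)
      (integrable_eval_gaussianReal_prod s _), integral_add (integrable_eval_gaussianReal_prod s _)
      (integrable_eval_gaussianReal_prod s _), hp, hq, mul_add]

theorem integral_complexGaussian (v : ℝ≥0) (f : ℂ → ℂ) :
    ∫ z, f z ∂(complexGaussian v) = ∫ z : ℝ × ℝ, f (z.1 + z.2 * Complex.I)
      ∂((gaussianReal 0 (v / 2)).prod (gaussianReal 0 (v / 2))) := by
  rw [complexGaussian, integral_map_equiv]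
  congr 1
  funext z
  rw [← Complex.mk_eq_add_mul_I]
  rfl

instance (v : ℝ≥0) : IsProbabilityMeasure (complexGaussian v) :=
  Measure.isProbabilityMeasure_map (Complex.measurableEquivRealProd.symm.measurable.aemeasurable)

theorem integrable_pow_mul_star_pow_complexGaussian (v : ℝ≥0) (a b : ℕ) :
    Integrable (fun z : ℂ => z ^ a * star z ^ b) (complexGaussian v) := by
  rw [complexGaussian, integrable_map_equiv]
  refine (integrable_eval_gaussianReal_prod (v / 2)
    ((MvPolynomial.X true + MvPolynomial.C Complex.I * MvPolynomial.X false) ^ a *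
      (MvPolynomial.X true - MvPolynomial.C Complex.I * MvPolynomial.X false) ^ b)).congr
      (ae_of_all _ fun z => ?_)
  have h : Complex.measurableEquivRealProd.symm z = z.1 + z.2 * Complex.I := by
    rw [← Complex.mk_eq_add_mul_I]
    rfl
  simp [h, mul_comm Complex.I, sub_eq_add_neg]

/-- This is `E[z̄ f] = v E[∂f/∂z]` for `f = z^a z̄^b`. As `z̄ = x - iy`, Stein's identity with
variance `v/2` in each real variable produces `(v/2)(∂_x - i∂_y) = v ∂_z`. The truncated `a - 1` is
harmless because of the factor `a`. -/
theorem integral_complexGaussian_star_mul {v : ℝ≥0} (hv : v ≠ 0) (a b : ℕ) :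
    ∫ z, z ^ a * star z ^ (b + 1) ∂(complexGaussian v) =
      v * (a * ∫ z, z ^ (a - 1) * star z ^ b ∂(complexGaussian v)) := by
  have hs : v / 2 ≠ 0 := by positivity
  let Z : MvPolynomial Bool ℂ :=
    MvPolynomial.X true + MvPolynomial.C Complex.I * MvPolynomial.X false
  let W : MvPolynomial Bool ℂ :=
    MvPolynomial.X true - MvPolynomial.C Complex.I * MvPolynomial.X false
  have hI : ∀ a b, ∫ z, z ^ a * star z ^ b ∂(complexGaussian v) =
      ∫ z : ℝ × ℝ, (Z ^ a * W ^ b).eval (fun b => bif b then (z.1 : ℂ) else z.2)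
      ∂((gaussianReal 0 (v / 2)).prod (gaussianReal 0 (v / 2))) := by
    intro a b
    rw [integral_complexGaussian]
    congr 1
    funext z
    simp [Z, W, mul_comm Complex.I, sub_eq_add_neg]
  rw [hI, hI]
  have hC : (MvPolynomial.C Complex.I : MvPolynomial Bool ℂ) * MvPolynomial.C Complex.I = -1 := by
    rw [← map_mul, Complex.I_mul_I, map_neg, map_one]
  -- The operator `∂_x - i∂_y` kills `W`, which is `z̄`, and sends `Z`, which is `z`, to 2.
  have hD : MvPolynomial.pderiv true (Z ^ a * W ^ b) -
      MvPolynomial.C Complex.I * MvPolynomial.pderiv false (Z ^ a * W ^ b) =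
      MvPolynomial.C (2 * a : ℂ) * (Z ^ (a - 1) * W ^ b) := by
    have t1 : MvPolynomial.pderiv true Z = 1 := by simp [Z]
    have t2 : MvPolynomial.pderiv true W = 1 := by simp [W]
    have t3 : MvPolynomial.pderiv false Z = MvPolynomial.C Complex.I := by
      simp [Z]
    have t4 : MvPolynomial.pderiv false W = - MvPolynomial.C Complex.I := by
      simp [W]
    simp only [MvPolynomial.pderiv_mul, MvPolynomial.pderiv_pow, t1, t2, t3, t4, map_mul,
      map_ofNat, map_natCast]
    linear_combination (-(a * Z ^ (a - 1) * W ^ b) + b * Z ^ a * W ^ (b - 1)) * hC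
  have e : Z ^ a * W ^ (b + 1) = MvPolynomial.X true * (Z ^ a * W ^ b) -
      MvPolynomial.C Complex.I * (MvPolynomial.X false * (Z ^ a * W ^ b)) := by
    rw [pow_succ]
    simp only [W]
    ring
  rw [e]
  simp only [map_sub, map_mul (MvPolynomial.eval _) (MvPolynomial.C Complex.I), MvPolynomial.eval_C]
  rw [integral_sub (integrable_eval_gaussianReal_prod _ _)
    ((integrable_eval_gaussianReal_prod _ _).const_mul _), integral_const_mul,
    integral_mul_eval_gaussianReal_prod hs, integral_mul_eval_gaussianReal_prod hs]
  have hD' := congrArg (fun P => ∫ z : ℝ × ℝ, P.eval (fun b => bif b then (z.1 : ℂ) else z.2)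
      ∂((gaussianReal 0 (v / 2)).prod (gaussianReal 0 (v / 2)))) hD
  simp only [map_sub, map_mul (MvPolynomial.eval _) (MvPolynomial.C _), MvPolynomial.eval_C] at hD'
  rw [integral_sub (integrable_eval_gaussianReal_prod _ _)
    ((integrable_eval_gaussianReal_prod _ _).const_mul _), integral_const_mul,
    integral_const_mul] at hD'
  push_cast
  linear_combination (v / 2 : ℂ) * hD'

/-! ### Expectations of polynomials in i.i.d. complex Gaussians -/

section Expectation

variable {ι : Type*} [Fintype ι]

/-- Evaluation of a polynomial in the variables `t e` (index `(e, false)`) and their conjugates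
(index `(e, true)`). -/
noncomputable def evalConj (t : ι → ℂ) : MvPolynomial (ι × Bool) ℂ →+* ℂ :=
  MvPolynomial.eval fun e => if e.2 then star (t e.1) else t e.1

theorem evalConj_monomial (t : ι → ℂ) (m : ι × Bool →₀ ℕ) (c : ℂ) :
    evalConj t (MvPolynomial.monomial m c) =
      c * ∏ e, (t e ^ m (e, false) * star (t e) ^ m (e, true)) := by
  simp [evalConj, MvPolynomial.eval_monomial, Finsupp.prod_fintype, Fintype.prod_prod_type,
    mul_comm]

theorem integrable_evalConj (v : ℝ≥0) (f : MvPolynomial (ι × Bool) ℂ) :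
    Integrable (fun t => evalConj t f) (Measure.pi fun _ : ι => complexGaussian v) := by
  induction f using MvPolynomial.induction_on' with
  | monomial m c =>
    simp only [evalConj_monomial]
    exact (Integrable.fintype_prod_dep fun e =>
      integrable_pow_mul_star_pow_complexGaussian v (m (e, false)) (m (e, true))).const_mul c
  | add p q hp hq => simp only [map_add]; exact hp.add hq

/-- The expectation of a polynomial in i.i.d. complex `N(0, v)` variables and their conjugates. -/
noncomputable def gaussianExpectation (ι : Type*) [Fintype ι] (v : ℝ≥0) :
    MvPolynomial (ι × Bool) ℂ →ₗ[ℂ] ℂ where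
  toFun f := ∫ t, evalConj t f ∂(Measure.pi fun _ : ι => complexGaussian v)
  map_add' f g := by
    simp only [map_add]
    exact integral_add (integrable_evalConj v f) (integrable_evalConj v g)
  map_smul' c f := by
    simp only [MvPolynomial.smul_eq_C_mul, map_mul, RingHom.id_apply, smul_eq_mul]
    rw [← integral_const_mul]
    simp [evalConj]

theorem gaussianExpectation_one (v : ℝ≥0) : gaussianExpectation ι v 1 = 1 := by
  simp [gaussianExpectation]

/-- Gaussian integration by parts. -/
theorem gaussianExpectation_star_mul {v : ℝ≥0} (hv : v ≠ 0) (e : ι)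
    (f : MvPolynomial (ι × Bool) ℂ) :
    gaussianExpectation ι v (MvPolynomial.X (e, true) * f) =
      v * gaussianExpectation ι v (MvPolynomial.pderiv (e, false) f) := by
  classical
  induction f using MvPolynomial.induction_on' with
  | monomial m c =>
    have h : ∀ (m : ι × Bool →₀ ℕ) (c : ℂ), gaussianExpectation ι v (MvPolynomial.monomial m c) =
        c * ∏ e, ∫ z, z ^ m (e, false) * star z ^ m (e, true) ∂(complexGaussian v) := by
      intro m c
      simp only [gaussianExpectation, LinearMap.coe_mk, AddHom.coe_mk, evalConj_monomial]
      rw [integral_const_mul, integral_fintype_prod_eq_prod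
        (fun e z => z ^ m (e, false) * star z ^ m (e, true))]
    rw [MvPolynomial.X, MvPolynomial.monomial_mul, one_mul, MvPolynomial.pderiv_monomial, h, h,
      Fintype.prod_eq_mul_prod_compl e, Fintype.prod_eq_mul_prod_compl (a := e)]
    have h2 : ∀ x ∈ ({e}ᶜ : Finset ι), x ≠ e := by simp
    have hp : ∏ x ∈ ({e}ᶜ : Finset ι),
        ∫ z, z ^ (Finsupp.single (e, true) 1 + m : ι × Bool →₀ ℕ) (x, false) *
          star z ^ (Finsupp.single (e, true) 1 + m : ι × Bool →₀ ℕ) (x, true) ∂(complexGaussian v) =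
        ∏ x ∈ ({e}ᶜ : Finset ι), ∫ z, z ^ (m - Finsupp.single (e, false) 1 : ι × Bool →₀ ℕ) (x, false) *
          star z ^ (m - Finsupp.single (e, false) 1 : ι × Bool →₀ ℕ) (x, true) ∂(complexGaussian v) :=
      Finset.prod_congr rfl fun x hx => by simp [(h2 x hx).symm]
    rw [hp]
    have h3 := integral_complexGaussian_star_mul hv (m (e, false)) (m (e, true))
    simp only [Finsupp.add_apply, Finsupp.tsub_apply, Finsupp.single_apply, Prod.mk.injEq, true_and,
      if_true, Bool.true_eq_false, Bool.false_eq_true, if_false, zero_add, tsub_zero,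
      add_comm 1]
    rw [h3]
    ring
  | add p q hp hq => rw [mul_add, map_add, map_add, map_add, hp, hq, mul_add]

end Expectation

/-! ### Rank one perturbations of matrices -/

section Perturbation

theorem add_pow_eq_sum_left {R : Type*} [Ring R] (A D : R) (p : ℕ) :
    (A + D) ^ p = A ^ p + ∑ l ∈ Finset.range p, A ^ (p - 1 - l) * D * (A + D) ^ l := by
  induction p with
  | zero => simp
  | succ p ih =>
    have h : ∑ l ∈ Finset.range p, A ^ (p + 1 - 1 - l) * D * (A + D) ^ l =
        A * ∑ l ∈ Finset.range p, A ^ (p - 1 - l) * D * (A + D) ^ l := by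
      rw [Finset.mul_sum]
      refine Finset.sum_congr rfl fun l hl => ?_
      have hl := Finset.mem_range.mp hl
      rw [show p + 1 - 1 - l = (p - 1 - l) + 1 by omega, pow_succ']
      simp only [mul_assoc]
    rw [Finset.sum_range_succ, h, pow_succ', add_mul]
    nth_rewrite 1 [ih]
    simp [mul_add, pow_succ', add_assoc]

theorem add_pow_eq_sum_right {R : Type*} [Ring R] (A D : R) (p : ℕ) :
    (A + D) ^ p = A ^ p + ∑ l ∈ Finset.range p, (A + D) ^ l * D * A ^ (p - 1 - l) := by
  induction p with
  | zero => simp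
  | succ p ih =>
    have h : ∑ l ∈ Finset.range p, (A + D) ^ l * D * A ^ (p + 1 - 1 - l) =
        (∑ l ∈ Finset.range p, (A + D) ^ l * D * A ^ (p - 1 - l)) * A := by
      rw [Finset.sum_mul]
      refine Finset.sum_congr rfl fun l hl => ?_
      have hl := Finset.mem_range.mp hl
      rw [show p + 1 - 1 - l = (p - 1 - l) + 1 by omega, pow_succ]
      simp only [mul_assoc]
    rw [Finset.sum_range_succ, h, pow_succ, mul_add]
    nth_rewrite 1 [ih]
    simp [add_mul, pow_succ, add_assoc]

theorem sum_range_sum_range {S : Type*} [CommRing S] (f : ℕ → S) (p : ℕ) :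
    ∑ i ∈ Finset.range (p + 1), ∑ l ∈ Finset.range i, f l =
      ∑ l ∈ Finset.range p, ((p - l : ℕ) : S) * f l := by
  induction p with
  | zero => simp
  | succ p ih =>
    rw [Finset.sum_range_succ, ih, Finset.sum_range_succ, Finset.sum_range_succ, ← add_assoc,
      ← Finset.sum_add_distrib]
    congr 1
    · refine Finset.sum_congr rfl fun l hl => ?_
      have hl := Finset.mem_range.mp hl
      rw [show p + 1 - l = (p - l) + 1 by omega]
      push_cast
      ring
    · simp

variable {m : Type*} [Fintype m] [DecidableEq m] {S : Type*} [CommRing S]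

-- Telescoping inserts one rank one factor between powers of `W` and of `W + x yᵀ`, which splits
-- each term into a product of two scalar forms. The case `a = 0` is the recursion defining
-- `perturbedForm`.
open Matrix in
theorem dotProduct_pow_mul_add_pow (W : Matrix m m S) (x y : m → S) (a p : ℕ) :
    y ⬝ᵥ ((W ^ a * (W + vecMulVec x y) ^ p) *ᵥ x) = y ⬝ᵥ (W ^ (a + p) *ᵥ x) +
      ∑ l ∈ Finset.range p, (y ⬝ᵥ (W ^ (a + (p - 1 - l)) *ᵥ x)) *
        (y ⬝ᵥ ((W + vecMulVec x y) ^ l *ᵥ x)) := by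
  rw [add_pow_eq_sum_left, mul_add, add_mulVec, dotProduct_add, ← pow_add, Finset.mul_sum,
    sum_mulVec, dotProduct_sum]
  congr 1
  refine Finset.sum_congr rfl fun l _ => ?_
  rw [← mul_assoc, ← mul_assoc, ← pow_add, ← mulVec_mulVec, ← mulVec_mulVec, vecMulVec_mulVec]
  rw [mulVec_smul, dotProduct_smul]
  simp [mul_comm]

open Matrix in
theorem perturbedForm_dotProduct (W : Matrix m m S) (x y : m → S) (i : ℕ) :
    perturbedForm (fun b => y ⬝ᵥ (W ^ b *ᵥ x)) i = y ⬝ᵥ ((W + vecMulVec x y) ^ i *ᵥ x) := by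
  induction i using Nat.strong_induction_on with
  | _ i ih =>
    have h := dotProduct_pow_mul_add_pow W x y 0 i
    rw [pow_zero, one_mul] at h
    rw [perturbedForm_eq, h, zero_add]
    congr 1
    refine Finset.sum_congr rfl fun l hl => ?_
    rw [ih l (Finset.mem_range.mp hl), zero_add]

-- After telescoping, cyclicity of the trace turns each of the `p + 1` terms into a form with `p`
-- factors. The product with index `j` occurs once for each `l` with `j < l ≤ p`, hence the
-- multiplicity `p - j` in `traceIncrement`.
open Matrix in
theorem trace_add_vecMulVec_pow (W : Matrix m m S) (x y : m → S) (p : ℕ) :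
    ((W + vecMulVec x y) ^ (p + 1)).trace = (W ^ (p + 1)).trace +
      traceIncrement (fun b => y ⬝ᵥ (W ^ b *ᵥ x)) (p + 1) := by
  have h : ∀ l ∈ Finset.range (p + 1),
      ((W + vecMulVec x y) ^ l * vecMulVec x y * W ^ (p + 1 - 1 - l)).trace =
      y ⬝ᵥ (W ^ p *ᵥ x) + ∑ j ∈ Finset.range l, (y ⬝ᵥ (W ^ (p - 1 - j) *ᵥ x)) *
        perturbedForm (fun b => y ⬝ᵥ (W ^ b *ᵥ x)) j := by
    intro l hl
    have hl := Finset.mem_range.mp hl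
    rw [trace_mul_comm, ← mul_assoc, mul_vecMulVec, trace_vecMulVec, dotProduct_comm,
      dotProduct_pow_mul_add_pow, show p + 1 - 1 - l + l = p by omega]
    congr 1
    refine Finset.sum_congr rfl fun j hj => ?_
    have hj := Finset.mem_range.mp hj
    rw [perturbedForm_dotProduct, show p + 1 - 1 - l + (l - 1 - j) = p - 1 - j by omega]
  rw [add_pow_eq_sum_right, trace_add, trace_sum, Finset.sum_congr rfl h, Finset.sum_add_distrib,
    sum_range_sum_range]
  simp [traceIncrement, mul_assoc]

theorem derivation_matrix_pow {R : Type*} [CommRing R] [Algebra R S] (D : Derivation R S S)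
    {W : Matrix m m S} (h : ∀ i j, D (W i j) = 0) (b : ℕ) (i j : m) : D ((W ^ b) i j) = 0 := by
  induction b generalizing i j with
  | zero => simp [Matrix.one_apply, apply_ite D]
  | succ b ih => simp [pow_succ, Matrix.mul_apply, h, ih]

end Perturbation

/-! ### The columns of the triangular Gaussian matrix -/

section Columns

/-- Polynomials in the entries of the triangular matrix and their conjugates. -/
abbrev EntryRing (n : ℕ) : Type := MvPolynomial (UpperIndex n × Bool) ℂ

/-- The `k`-th column of the triangular matrix (`s = false`) or its entrywise conjugate
(`s = true`). -/
noncomputable def entryCol {n : ℕ} (s : Bool) (k : ℕ) (i : Fin n) : EntryRing n :=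
  if h : i.1 < k ∧ k < n then MvPolynomial.X (⟨(i, ⟨k, h.2⟩), h.1⟩, s) else 0

/-- The sum of the `x x*` over the first `k` columns `x`. -/
noncomputable def partialGram (n k : ℕ) : Matrix (Fin n) (Fin n) (EntryRing n) :=
  ∑ j ∈ Finset.range k, Matrix.vecMulVec (entryCol false j) (entryCol true j)

theorem partialGram_succ (n k : ℕ) : partialGram n (k + 1) = partialGram n k +
    Matrix.vecMulVec (entryCol false k) (entryCol true k) :=
  Finset.sum_range_succ _ _

theorem partialGram_apply (n k : ℕ) (i j : Fin n) : partialGram n k i j =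
    ∑ l ∈ Finset.range k, entryCol false l i * entryCol true l j := by
  simp [partialGram, Matrix.sum_apply, Matrix.vecMulVec_apply]

theorem entryCol_of_le {n k : ℕ} {i : Fin n} (s : Bool) (h : k ≤ i.1) : entryCol s k i = 0 := by
  rw [entryCol, dif_neg (by omega)]

theorem partialGram_of_le {n k : ℕ} {i : Fin n} (h : k ≤ i.1) (j : Fin n) :
    partialGram n k i j = 0 := by
  rw [partialGram_apply]
  refine Finset.sum_eq_zero fun l hl => ?_
  rw [entryCol_of_le _ (by have := Finset.mem_range.mp hl; omega), zero_mul]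

/-- The trace of the `a`-th power of `partialGram n k`, compressed to the first `k` coordinates,
and multiplied by `v`. -/
noncomputable def gramTrace (v : ℝ≥0) (n k a : ℕ) : EntryRing n :=
  MvPolynomial.C (v : ℂ) * ∑ i : Fin n, if i.1 < k then (partialGram n k ^ a) i i else 0

/-- The vector `W^b x` for `W = partialGram n k` and `x` the `k`-th column. -/
noncomputable def gramVec (n k b : ℕ) : Fin n → EntryRing n :=
  (partialGram n k ^ b).mulVec (entryCol false k)

/-- The quadratic form `x* W^b x` for `W = partialGram n k` and `x` the `k`-th column. -/
noncomputable def gramForm (n k b : ℕ) : EntryRing n :=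
  dotProduct (entryCol true k) (gramVec n k b)

theorem gramTrace_zero (v : ℝ≥0) (n a : ℕ) : gramTrace v n 0 a = 0 := by simp [gramTrace]

/-- For positive exponents the compression is invisible, since the rows of index at least `k`
vanish. At exponent 0 it yields `k`, the number of free entries of column `k`, instead of `n`. -/
theorem gramTrace_succ_exp (v : ℝ≥0) (n k a : ℕ) :
    gramTrace v n k (a + 1) = MvPolynomial.C (v : ℂ) * (partialGram n k ^ (a + 1)).trace := by
  rw [gramTrace, Matrix.trace]
  congr 1
  refine Finset.sum_congr rfl fun i _ => ?_
  split_ifs with h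
  · rfl
  · rw [Matrix.diag_apply, pow_succ', Matrix.mul_apply]
    exact (Finset.sum_eq_zero fun j _ => by rw [partialGram_of_le (by omega), zero_mul]).symm

theorem gramTrace_zero_exp (v : ℝ≥0) {n k : ℕ} (hk : k ≤ n) :
    gramTrace v n k 0 = MvPolynomial.C (v : ℂ) * (k : EntryRing n) := by
  rw [gramTrace]
  congr 1
  simp only [pow_zero, Matrix.one_apply_eq]
  rw [Finset.sum_boole, Fin.card_filter_val_lt, min_eq_right hk]

/-- At exponent 0 the increment is the one new coordinate, which is why `traceIncrement q 0 = 1`. -/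
theorem gramTrace_succ (v : ℝ≥0) {n k : ℕ} (hk : k < n) (a : ℕ) :
    gramTrace v n (k + 1) a = gramTrace v n k a +
      MvPolynomial.C (v : ℂ) * traceIncrement (gramForm n k) a := by
  cases a with
  | zero =>
    rw [gramTrace_zero_exp v hk, gramTrace_zero_exp v hk.le, traceIncrement]
    push_cast
    ring
  | succ a =>
    rw [gramTrace_succ_exp, gramTrace_succ_exp, partialGram_succ, trace_add_vecMulVec_pow, mul_add]
    rfl

theorem gramVec_of_le {n k : ℕ} (b : ℕ) {i : Fin n} (h : k ≤ i.1) : gramVec n k b i = 0 := by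
  cases b with
  | zero => simp [gramVec, entryCol_of_le _ h]
  | succ b =>
    rw [gramVec, pow_succ', ← Matrix.mulVec_mulVec, Matrix.mulVec, dotProduct]
    exact Finset.sum_eq_zero fun j _ => by rw [partialGram_of_le h, zero_mul]

/-- The derivation `∑ i, (W^b x)_i ∂/∂x_i`, where `x` is the `k`-th column. -/
noncomputable def gramDerivation (n k b : ℕ) : Derivation ℂ (EntryRing n) (EntryRing n) :=
  ∑ i : Fin n, if h : i.1 < k ∧ k < n then
    gramVec n k b i • MvPolynomial.pderiv (⟨(i, ⟨k, h.2⟩), h.1⟩, false) else 0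

theorem pderiv_entryCol_of_ne {n k l : ℕ} {i : Fin n} (h : i.1 < k ∧ k < n) (s : Bool)
    (j : Fin n) (hl : s = true ∨ l ≠ k) :
    MvPolynomial.pderiv (R := ℂ) ((⟨(i, ⟨k, h.2⟩), h.1⟩ : UpperIndex n), false)
      (entryCol s l j) = 0 := by
  rw [entryCol]
  split_ifs
  · refine MvPolynomial.pderiv_X_of_ne fun he => ?_
    simp only [Prod.mk.injEq, Subtype.mk.injEq, Fin.mk.injEq] at he
    rcases hl with rfl | hl
    · simp at he
    · exact hl he.1.2
  · simp

theorem pderiv_entryCol_self {n k : ℕ} {i : Fin n} (h : i.1 < k ∧ k < n) (j : Fin n) :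
    MvPolynomial.pderiv (R := ℂ) ((⟨(i, ⟨k, h.2⟩), h.1⟩ : UpperIndex n), false)
      (entryCol false k j) = if j = i then 1 else 0 := by
  split_ifs with hj
  · subst hj
    rw [entryCol, dif_pos h, MvPolynomial.pderiv_X_self]
  · rw [entryCol]
    split_ifs
    · refine MvPolynomial.pderiv_X_of_ne fun he => hj ?_
      simp only [Prod.mk.injEq, Subtype.mk.injEq] at he
      exact he.1.1
    · simp

/-- The matrix involves only columns before `k`: the algebraic form of independence. -/
theorem pderiv_partialGram_pow {n k : ℕ} {i : Fin n} (h : i.1 < k ∧ k < n) (b : ℕ)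
    (j l : Fin n) : MvPolynomial.pderiv (R := ℂ) ((⟨(i, ⟨k, h.2⟩), h.1⟩ : UpperIndex n), false)
      ((partialGram n k ^ b) j l) = 0 := by
  refine derivation_matrix_pow _ (fun j l => ?_) b j l
  rw [partialGram_apply, map_sum]
  refine Finset.sum_eq_zero fun t ht => ?_
  have ht := Finset.mem_range.mp ht
  rw [Derivation.leibniz, pderiv_entryCol_of_ne h _ _ (.inl rfl),
    pderiv_entryCol_of_ne h _ _ (.inr (by omega))]
  simp

theorem pderiv_gramVec {n k : ℕ} {i : Fin n} (h : i.1 < k ∧ k < n) (b : ℕ)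
    (j : Fin n) : MvPolynomial.pderiv (R := ℂ) ((⟨(i, ⟨k, h.2⟩), h.1⟩ : UpperIndex n), false)
      (gramVec n k b j) = (partialGram n k ^ b) j i := by
  rw [gramVec, Matrix.mulVec, dotProduct, map_sum]
  simp [pderiv_partialGram_pow h, pderiv_entryCol_self h]

theorem pderiv_gramForm {n k : ℕ} {i : Fin n} (h : i.1 < k ∧ k < n) (b : ℕ) :
    MvPolynomial.pderiv (R := ℂ) ((⟨(i, ⟨k, h.2⟩), h.1⟩ : UpperIndex n), false)
      (gramForm n k b) = ∑ j, entryCol true k j * (partialGram n k ^ b) j i := by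
  rw [gramForm, dotProduct, map_sum]
  refine Finset.sum_congr rfl fun j _ => ?_
  rw [Derivation.leibniz, pderiv_gramVec h, pderiv_entryCol_of_ne h _ _ (.inl rfl)]
  simp

theorem gramDerivation_apply (n k b : ℕ) (f : EntryRing n) : gramDerivation n k b f =
    ∑ i : Fin n, if h : i.1 < k ∧ k < n then
      gramVec n k b i * MvPolynomial.pderiv (⟨(i, ⟨k, h.2⟩), h.1⟩, false) f else 0 := by
  refine (congrFun (map_sum (Derivation.coeFnAddMonoidHom (R := ℂ) (A := EntryRing n)
    (M := EntryRing n)) _ Finset.univ) f).trans ?_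
  rw [Finset.sum_apply]
  refine Finset.sum_congr rfl fun i _ => ?_
  split_ifs <;> simp [Derivation.coeFnAddMonoidHom]

theorem gramDerivation_gramTrace (v : ℝ≥0) (n k b a : ℕ) :
    gramDerivation n k b (gramTrace v n k a) = 0 := by
  rw [gramDerivation_apply]
  refine Finset.sum_eq_zero fun i _ => ?_
  split_ifs with h
  · rw [gramTrace, MvPolynomial.pderiv_C_mul, map_sum, Finset.sum_eq_zero, mul_zero, mul_zero]
    intro j _
    split_ifs
    · exact pderiv_partialGram_pow h _ _ _
    · simp
  · rfl

/-- The derivation replaces `x` by `W^b x` and leaves `x*` alone, conjugates being separate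
variables; so `x* W^c x` becomes `x* W^(b+c) x`. -/
theorem gramDerivation_gramForm {n k : ℕ} (hk : k < n) (b c : ℕ) :
    gramDerivation n k b (gramForm n k c) = gramForm n k (b + c) := by
  have h1 : gramForm n k (b + c) = ∑ i : Fin n, ∑ j : Fin n,
      gramVec n k b i * (entryCol true k j * (partialGram n k ^ c) j i) := by
    rw [gramForm, gramVec, add_comm, pow_add, ← Matrix.mulVec_mulVec, ← gramVec, dotProduct,
      Finset.sum_comm]
    refine Finset.sum_congr rfl fun j _ => ?_
    rw [Matrix.mulVec, dotProduct, Finset.mul_sum]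
    exact Finset.sum_congr rfl fun i _ => by ring
  rw [gramDerivation_apply, h1]
  refine Finset.sum_congr rfl fun i _ => ?_
  split_ifs with h
  · rw [pderiv_gramForm h, Finset.mul_sum]
  · rw [gramVec_of_le b (by omega)]
    simp

/-- Integrate by parts in each entry of `x*`. Differentiating `W^b x` produces the diagonal of
`W^b`, hence the trace; differentiating `f` produces the derivation. -/
theorem gaussianExpectation_gramForm_mul {v : ℝ≥0} (hv : v ≠ 0) {n k : ℕ} (hk : k < n) (b : ℕ)
    (f : EntryRing n) :
    gaussianExpectation (UpperIndex n) v (gramForm n k b * f) =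
      gaussianExpectation (UpperIndex n) v (gramTrace v n k b * f) +
        v * gaussianExpectation (UpperIndex n) v (gramDerivation n k b f) := by
  have h1 : gramForm n k b * f = ∑ i : Fin n, entryCol true k i * (gramVec n k b i * f) := by
    rw [gramForm, dotProduct, Finset.sum_mul]
    simp only [mul_assoc]
  have h2 : gramTrace v n k b * f = (v : ℂ) • ∑ i : Fin n,
      if i.1 < k then (partialGram n k ^ b) i i * f else 0 := by
    rw [gramTrace, MvPolynomial.smul_eq_C_mul, mul_assoc, Finset.sum_mul]
    simp only [ite_mul, zero_mul]
  rw [h1, h2, gramDerivation_apply, map_smul, map_sum, map_sum, map_sum, smul_eq_mul, ← mul_add,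
    ← Finset.sum_add_distrib, Finset.mul_sum]
  refine Finset.sum_congr rfl fun i _ => ?_
  by_cases h : i.1 < k ∧ k < n
  · rw [dif_pos h, if_pos h.1, entryCol, dif_pos h, gaussianExpectation_star_mul hv,
      Derivation.leibniz, pderiv_gramVec h, ← map_add]
    simp only [smul_eq_mul]
    rw [add_comm, mul_comm f]
  · rw [dif_neg h, if_neg (by omega), entryCol, dif_neg h]
    simp

end Columns

/-! ### Asymptotics of the mixed trace moments -/

/-- Formal variables: the variance, the traces `gramTrace`, the quadratic forms `gramForm`. -/
inductive TraceVar : Type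
  | scale : TraceVar
  | tr (a : ℕ) : TraceVar
  | form (b : ℕ) : TraceVar

namespace TraceVar

/-- The weight of a formal variable. -/
def weight : TraceVar → ℕ
  | scale => 0
  | tr a => a + 1
  | form b => b + 1

/-- The weight of a list of variables. -/
def listWeight (l : List TraceVar) : ℕ := (l.map weight).sum

/-- The monomial given by a list of variables. -/
noncomputable def mon (l : List TraceVar) : MvPolynomial TraceVar ℂ :=
  (l.map MvPolynomial.X).prod

theorem mon_cons (i : TraceVar) (l : List TraceVar) : mon (i :: l) = MvPolynomial.X i * mon l := by
  simp [mon]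

theorem mon_append (l l' : List TraceVar) : mon (l ++ l') = mon l * mon l' := by simp [mon]

theorem listWeight_cons (i : TraceVar) (l : List TraceVar) :
    listWeight (i :: l) = weight i + listWeight l := by
  simp [listWeight]

theorem listWeight_append (l l' : List TraceVar) :
    listWeight (l ++ l') = listWeight l + listWeight l' := by
  simp [listWeight]

/-- The polynomials of weight at most `w`. -/
noncomputable def weightLE (w : ℕ) : Submodule ℂ (MvPolynomial TraceVar ℂ) :=
  Submodule.span ℂ {f | ∃ l, listWeight l ≤ w ∧ f = mon l}

theorem mon_mem_weightLE {w : ℕ} {l : List TraceVar} (h : listWeight l ≤ w) :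
    mon l ∈ weightLE w :=
  Submodule.subset_span ⟨l, h, rfl⟩

theorem X_mem_weightLE {w : ℕ} {i : TraceVar} (h : weight i ≤ w) :
    MvPolynomial.X i ∈ weightLE w := by
  have := mon_mem_weightLE (l := [i]) (w := w) (by simpa [listWeight] using h)
  simpa [mon] using this

theorem one_mem_weightLE (w : ℕ) : (1 : MvPolynomial TraceVar ℂ) ∈ weightLE w :=
  mon_mem_weightLE (l := []) (by simp [listWeight])

theorem mul_mem_weightLE {a b w : ℕ} {f g : MvPolynomial TraceVar ℂ} (hf : f ∈ weightLE a)
    (hg : g ∈ weightLE b) (hw : a + b ≤ w) : f * g ∈ weightLE w := by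
  have h := Submodule.mul_mem_mul hf hg
  rw [weightLE, weightLE, Submodule.span_mul_span] at h
  refine Submodule.span_mono ?_ h
  rintro _ ⟨_, ⟨l, hl, rfl⟩, _, ⟨l', hl', rfl⟩, rfl⟩
  exact ⟨l ++ l', by rw [listWeight_append]; omega, (mon_append l l').symm⟩

theorem natCast_mul_mem_weightLE {w : ℕ} {f : MvPolynomial TraceVar ℂ} (hf : f ∈ weightLE w)
    (c : ℕ) : (c : MvPolynomial TraceVar ℂ) * f ∈ weightLE w := by
  rw [← nsmul_eq_mul]
  exact (weightLE w).nsmul_mem hf c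

/-- The formal version of `traceIncrement`. -/
noncomputable def formIncrement (a : ℕ) : MvPolynomial TraceVar ℂ :=
  traceIncrement (fun b => MvPolynomial.X (form b)) a

theorem perturbedForm_mem_weightLE (i : ℕ) :
    perturbedForm (fun b => MvPolynomial.X (form b)) i ∈ weightLE (i + 1) := by
  induction i using Nat.strong_induction_on with
  | _ i ih =>
    rw [perturbedForm_eq]
    refine add_mem (X_mem_weightLE le_rfl) (sum_mem fun l hl => ?_)
    have hl := Finset.mem_range.mp hl
    exact mul_mem_weightLE (X_mem_weightLE le_rfl) (ih l hl) (by simp only [weight]; omega)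

theorem formIncrement_mem_weightLE (a : ℕ) : formIncrement a ∈ weightLE a := by
  cases a with
  | zero => exact one_mem_weightLE 0
  | succ p =>
    rw [formIncrement, traceIncrement]
    refine add_mem ?_ (sum_mem fun l hl => ?_)
    · exact_mod_cast natCast_mul_mem_weightLE (X_mem_weightLE (i := form p) le_rfl) (p + 1)
    · have hl := Finset.mem_range.mp hl
      rw [mul_assoc]
      exact natCast_mul_mem_weightLE (mul_mem_weightLE (X_mem_weightLE le_rfl)
        (perturbedForm_mem_weightLE l) (by simp only [weight]; omega)) _

/-- The substitution expressing the traces for `k + 1` through the data for `k`. -/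
noncomputable def shift : MvPolynomial TraceVar ℂ →ₐ[ℂ] MvPolynomial TraceVar ℂ :=
  MvPolynomial.aeval fun i => match i with
    | tr a => MvPolynomial.X (tr a) + MvPolynomial.X scale * formIncrement a
    | scale => MvPolynomial.X scale
    | form b => MvPolynomial.X (form b)

/-- The formal derivation corresponding to `gramDerivation`. -/
noncomputable def formDerivation (b : ℕ) :
    Derivation ℂ (MvPolynomial TraceVar ℂ) (MvPolynomial TraceVar ℂ) :=
  MvPolynomial.mkDerivation ℂ fun i => match i with
    | tr _ => 0
    | scale => 0
    | form c => MvPolynomial.X (form (b + c))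

/-- The value of the variables at the matrices of size `n`. -/
noncomputable def realize (v : ℝ≥0) (n k : ℕ) : MvPolynomial TraceVar ℂ →ₐ[ℂ] EntryRing n :=
  MvPolynomial.aeval fun i => match i with
    | scale => MvPolynomial.C (v : ℂ)
    | tr a => gramTrace v n k a
    | form b => gramForm n k b

/-- The limiting value of the variables. -/
noncomputable def limitEval (t : ℂ) : MvPolynomial TraceVar ℂ →ₐ[ℂ] ℂ :=
  MvPolynomial.aeval fun i => match i with
    | scale => 0
    | tr a => treeMoment a * t ^ (a + 1)
    | form b => treeMoment b * t ^ (b + 1)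

/-- The expectation of a polynomial in the variables for matrices of size `n`. -/
noncomputable def mixedMoment (n k : ℕ) : MvPolynomial TraceVar ℂ →ₗ[ℂ] ℂ :=
  gaussianExpectation (UpperIndex n) (1 / (n : ℝ≥0)) ∘ₗ (realize (1 / (n : ℝ≥0)) n k).toLinearMap

/-- The right side is the `t`-derivative of `treeMoment a * t ^ (a + 1)`: the limiting profile
solves the flow. -/
theorem limitEval_formIncrement (t : ℂ) (a : ℕ) :
    limitEval t (formIncrement a) = (a + 1) * treeMoment a * t ^ a := by
  have h := map_traceIncrement (limitEval t)
    (fun b => MvPolynomial.X (form b)) a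
  have h2 : (fun b => (limitEval t) (MvPolynomial.X (form b))) =
      fun b => treeMoment b * t ^ (b + 1) := by
    funext b
    simp [limitEval]
  rw [h2, traceIncrement_scale, traceIncrement_treeMoment] at h
  exact h

theorem limitEval_shift (t : ℂ) (f : MvPolynomial TraceVar ℂ) :
    limitEval t (shift f) = limitEval t f := by
  have h : (limitEval t).comp shift = limitEval t := by
    refine MvPolynomial.algHom_ext fun i => ?_
    cases i <;> simp [limitEval, shift]
  exact DFunLike.congr_fun h f

/-- Only for products of traces: `form b` always refers to the current column, so `shift` does not
carry it from `k` to `k + 1`. -/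
theorem realize_shift_tr (v : ℝ≥0) {n k : ℕ} (hk : k < n) (l : List ℕ) :
    realize v n k (shift (mon (l.map tr))) = realize v n (k + 1) (mon (l.map tr)) := by
  induction l with
  | nil => simp [mon]
  | cons a l ih =>
    rw [List.map_cons, mon_cons, map_mul, map_mul, map_mul, ih]
    refine congrArg (· * _) ?_
    have h := map_traceIncrement (realize v n k)
      (fun b => MvPolynomial.X (form b)) a
    have h2 : (fun b => (realize v n k) (MvPolynomial.X (form b))) =
        gramForm n k := by
      funext b
      simp [realize]
    rw [h2] at h
    rw [← formIncrement] at h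
    have h4 : shift (MvPolynomial.X (tr a)) =
      MvPolynomial.X (tr a) + MvPolynomial.X scale * formIncrement a := by simp [shift]
    rw [h4, map_add, map_mul, h]
    simp [realize, gramTrace_succ v hk]

theorem gramDerivation_realize (v : ℝ≥0) {n k : ℕ} (hk : k < n) (b : ℕ)
    (f : MvPolynomial TraceVar ℂ) :
    gramDerivation n k b (realize v n k f) = realize v n k (formDerivation b f) := by
  induction f using MvPolynomial.induction_on with
  | C c => simp [MvPolynomial.derivation_C, ← MvPolynomial.algebraMap_eq]
  | add p q hp hq => simp only [map_add, hp, hq]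
  | mul_X p i hp =>
    rw [map_mul, Derivation.leibniz, Derivation.leibniz, hp, map_add]
    simp only [smul_eq_mul, map_mul]
    congr 2
    cases i
    · simp [realize, formDerivation, ← MvPolynomial.algebraMap_eq]
    · simp [realize, formDerivation, gramDerivation_gramTrace]
    · simp [realize, formDerivation, gramDerivation_gramForm hk]

theorem mixedMoment_scale_mul (n k : ℕ) (f : MvPolynomial TraceVar ℂ) :
    mixedMoment n k (MvPolynomial.X scale * f) = 1 / (n : ℂ) * mixedMoment n k f := by
  simp only [mixedMoment, LinearMap.comp_apply, AlgHom.toLinearMap_apply, map_mul]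
  have : realize (1 / (n : ℝ≥0)) n k (MvPolynomial.X scale) = MvPolynomial.C (1 / (n : ℂ)) := by
    simp [realize]
  rw [this, ← MvPolynomial.smul_eq_C_mul, map_smul, smul_eq_mul]

theorem mixedMoment_form_mul {n k : ℕ} (hk : k < n) (b : ℕ) (f : MvPolynomial TraceVar ℂ) :
    mixedMoment n k (MvPolynomial.X (form b) * f) = mixedMoment n k (MvPolynomial.X (tr b) * f) +
      mixedMoment n k (MvPolynomial.X scale * formDerivation b f) := by
  have hv : (1 / (n : ℝ≥0)) ≠ 0 := by
    have : (n : ℝ≥0) ≠ 0 := by exact_mod_cast (by omega : n ≠ 0)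
    positivity
  rw [mixedMoment_scale_mul]
  simp only [mixedMoment, LinearMap.comp_apply, AlgHom.toLinearMap_apply, map_mul]
  have h1 : realize (1 / (n : ℝ≥0)) n k (MvPolynomial.X (form b)) = gramForm n k b := by
    simp [realize]
  have h2 : realize (1 / (n : ℝ≥0)) n k (MvPolynomial.X (tr b)) =
      gramTrace (1 / (n : ℝ≥0)) n k b := by
    simp [realize]
  rw [h1, h2, gaussianExpectation_gramForm_mul hv hk, gramDerivation_realize _ hk]
  push_cast
  rfl

/-- One less than the weight of `form b` times the monomial, so the correction in the integration by
parts falls under the induction hypothesis. -/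
theorem formDerivation_mon_mem_weightLE (b : ℕ) (l : List TraceVar) :
    formDerivation b (mon l) ∈ weightLE (listWeight l + b) := by
  induction l with
  | nil => simp [mon]
  | cons i l ih =>
    rw [mon_cons, Derivation.leibniz, listWeight_cons]
    refine add_mem (mul_mem_weightLE (X_mem_weightLE le_rfl) ih (by omega)) ?_
    refine mul_mem_weightLE (mon_mem_weightLE le_rfl) (b := weight i + b) ?_ (by omega)
    cases i
    · simp [formDerivation]
    · simp [formDerivation]
    · simp only [formDerivation, MvPolynomial.mkDerivation_X]
      exact X_mem_weightLE (by simp only [weight]; omega)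

/-- The polynomials whose expectation converges to the limiting value at rate `1 / n`. -/
noncomputable def asymptotic : Submodule ℂ (MvPolynomial TraceVar ℂ) where
  carrier := {f | ∃ C : ℝ, ∀ n k : ℕ, k < n →
    ‖mixedMoment n k f - limitEval ((k : ℂ) / n) f‖ ≤ C / n}
  zero_mem' := ⟨0, by simp⟩
  add_mem' := by
    rintro f g ⟨C, hC⟩ ⟨D, hD⟩
    refine ⟨C + D, fun n k hk => ?_⟩
    rw [map_add, map_add, add_sub_add_comm, add_div]
    exact (norm_add_le _ _).trans (add_le_add (hC n k hk) (hD n k hk))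
  smul_mem' := by
    rintro c f ⟨C, hC⟩
    refine ⟨‖c‖ * C, fun n k hk => ?_⟩
    rw [map_smul, map_smul, ← smul_sub, norm_smul, mul_div_assoc]
    exact mul_le_mul_of_nonneg_left (hC n k hk) (norm_nonneg _)

theorem exists_norm_limitEval_le (f : MvPolynomial TraceVar ℂ) :
    ∃ B : ℝ, ∀ t : ℂ, ‖t‖ ≤ 1 → ‖limitEval t f‖ ≤ B := by
  induction f using MvPolynomial.induction_on with
  | C c => exact ⟨‖c‖, fun t _ => by simp [limitEval]⟩
  | add p q hp hq =>
    obtain ⟨B, hB⟩ := hp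
    obtain ⟨D, hD⟩ := hq
    refine ⟨B + D, fun t ht => ?_⟩
    rw [map_add]
    exact (norm_add_le _ _).trans (add_le_add (hB t ht) (hD t ht))
  | mul_X p i hp =>
    obtain ⟨B, hB⟩ := hp
    obtain ⟨D, hD⟩ : ∃ D : ℝ, ∀ t : ℂ, ‖t‖ ≤ 1 → ‖limitEval t (MvPolynomial.X i)‖ ≤ D := by
      have h : ∀ (a : ℕ) (t : ℂ), ‖t‖ ≤ 1 → ‖treeMoment a * t ^ (a + 1)‖ ≤ ‖treeMoment a‖ := by
        intro a t ht
        rw [norm_mul, norm_pow]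
        exact mul_le_of_le_one_right (norm_nonneg _) (pow_le_one₀ (norm_nonneg _) ht)
      cases i with
      | scale => exact ⟨0, fun t _ => by simp [limitEval]⟩
      | tr a => exact ⟨‖treeMoment a‖, fun t ht => by simpa [limitEval] using h a t ht⟩
      | form a => exact ⟨‖treeMoment a‖, fun t ht => by simpa [limitEval] using h a t ht⟩
    refine ⟨B * D, fun t ht => ?_⟩
    rw [map_mul, norm_mul]
    exact mul_le_mul (hB t ht) (hD t ht) (norm_nonneg _) ((norm_nonneg _).trans (hB t ht))

theorem norm_natCast_div_le_one {n k : ℕ} (hk : k ≤ n) : ‖(k : ℂ) / n‖ ≤ 1 := by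
  rw [norm_div, Complex.norm_natCast, Complex.norm_natCast]
  exact div_le_one_of_le₀ (by exact_mod_cast hk) (Nat.cast_nonneg _)

/-- The factor `1/n` is the whole error: the expectations of `f` stay bounded because their limits
are bounded for `‖t‖ ≤ 1`. -/
theorem scale_mul_mem_asymptotic {f : MvPolynomial TraceVar ℂ} (hf : f ∈ asymptotic) :
    MvPolynomial.X scale * f ∈ asymptotic := by
  obtain ⟨C, hC⟩ := hf
  obtain ⟨B, hB⟩ := exists_norm_limitEval_le f
  refine ⟨C + B, fun n k hk => ?_⟩
  have hn : (1 : ℝ) ≤ n := by exact_mod_cast (by omega : 1 ≤ n)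
  have h0 : limitEval ((k : ℂ) / n) (MvPolynomial.X scale * f) = 0 := by simp [limitEval]
  have h1 := hC n k hk
  have h2 := hB _ (norm_natCast_div_le_one hk.le)
  have hC0 : 0 ≤ C / n := (norm_nonneg _).trans h1
  -- The sign of `C` is not part of the hypothesis; it is forced by the bound `hC0` at this `n`.
  have hC1 : C / n ≤ C := by
    refine div_le_self ?_ hn
    by_contra! h
    exact absurd hC0 (not_le.mpr (div_neg_of_neg_of_pos h (by linarith)))
  rw [h0, sub_zero, mixedMoment_scale_mul, norm_mul, norm_div, norm_one, Complex.norm_natCast,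
    one_div, ← div_eq_inv_mul]
  gcongr
  calc ‖mixedMoment n k f‖ ≤ ‖mixedMoment n k f - limitEval ((k : ℂ) / n) f‖ +
        ‖limitEval ((k : ℂ) / n) f‖ := by
        simpa using norm_add_le (mixedMoment n k f - limitEval ((k : ℂ) / n) f)
          (limitEval ((k : ℂ) / n) f)
    _ ≤ C + B := by linarith

theorem form_mul_mem_asymptotic {b : ℕ} {f : MvPolynomial TraceVar ℂ}
    (h1 : MvPolynomial.X (tr b) * f ∈ asymptotic) (h2 : formDerivation b f ∈ asymptotic) :
    MvPolynomial.X (form b) * f ∈ asymptotic := by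
  obtain ⟨C, hC⟩ := h1
  obtain ⟨D, hD⟩ := scale_mul_mem_asymptotic h2
  refine ⟨C + D, fun n k hk => ?_⟩
  have e : limitEval ((k : ℂ) / n) (MvPolynomial.X (form b) * f) =
      limitEval ((k : ℂ) / n) (MvPolynomial.X (tr b) * f) +
      limitEval ((k : ℂ) / n) (MvPolynomial.X scale * formDerivation b f) := by
    simp [limitEval]
  rw [mixedMoment_form_mul hk, e, add_sub_add_comm, add_div]
  exact (norm_add_le _ _).trans (add_le_add (hC n k hk) (hD n k hk))

/-- The formal difference quotient of a product of traces. -/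
noncomputable def increment : List ℕ → MvPolynomial TraceVar ℂ
  | [] => 0
  | a :: l => MvPolynomial.X (tr a) * increment l + formIncrement a * shift (mon (l.map tr))

theorem shift_mon_tr (l : List ℕ) :
    shift (mon (l.map tr)) = mon (l.map tr) + MvPolynomial.X scale * increment l := by
  induction l with
  | nil => simp [mon, increment]
  | cons a l ih =>
    have h4 : shift (MvPolynomial.X (tr a)) =
      MvPolynomial.X (tr a) + MvPolynomial.X scale * formIncrement a := by simp [shift]
    rw [List.map_cons, mon_cons, map_mul, increment, h4, ih]
    ring

theorem shift_mon_tr_mem_weightLE (l : List ℕ) :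
    shift (mon (l.map tr)) ∈ weightLE (listWeight (l.map tr)) := by
  induction l with
  | nil => simpa [mon] using one_mem_weightLE _
  | cons a l ih =>
    have h4 : shift (MvPolynomial.X (tr a)) =
      MvPolynomial.X (tr a) + MvPolynomial.X scale * formIncrement a := by simp [shift]
    rw [List.map_cons, mon_cons, map_mul, h4, listWeight_cons]
    refine mul_mem_weightLE (add_mem (X_mem_weightLE le_rfl) ?_) ih le_rfl
    exact mul_mem_weightLE (X_mem_weightLE (i := scale) le_rfl) (formIncrement_mem_weightLE a)
      (by simp only [weight]; omega)

/-- Each term trades one `tr a`, of weight `a + 1`, for `formIncrement a`, of weight `a`, and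
`scale` has weight 0. -/
theorem increment_mem_weightLE (l : List ℕ) {w : ℕ} (h : listWeight (l.map tr) ≤ w + 1) :
    increment l ∈ weightLE w := by
  induction l generalizing w with
  | nil => simp [increment]
  | cons a l ih =>
    rw [List.map_cons, listWeight_cons, weight] at h
    rw [increment]
    refine add_mem ?_ (mul_mem_weightLE (formIncrement_mem_weightLE a)
      (shift_mon_tr_mem_weightLE l) (by omega))
    cases l with
    | nil => simp [increment]
    | cons c l =>
      rw [List.map_cons, listWeight_cons, weight] at h
      refine mul_mem_weightLE (X_mem_weightLE le_rfl) (b := w - a - 1) (ih ?_)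
        (by simp only [weight]; omega)
      rw [List.map_cons, listWeight_cons, weight]
      omega

theorem limitEval_mon_tr (t : ℂ) (l : List ℕ) :
    limitEval t (mon (l.map tr)) = (l.map treeMoment).prod * t ^ listWeight (l.map tr) := by
  induction l with
  | nil => simp [mon, listWeight]
  | cons a l ih =>
    rw [List.map_cons, mon_cons, map_mul, ih, listWeight_cons, weight, pow_add]
    simp [limitEval]
    ring

theorem limitEval_increment (t : ℂ) (l : List ℕ) :
    limitEval t (increment l) = (l.map treeMoment).prod *
      (listWeight (l.map tr) * t ^ (listWeight (l.map tr) - 1)) := by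
  induction l with
  | nil => simp [increment, listWeight]
  | cons a l ih =>
    have e : limitEval t (MvPolynomial.X (tr a)) = treeMoment a * t ^ (a + 1) := by
      simp [limitEval]
    rw [increment, map_add, map_mul, map_mul, ih, limitEval_shift, limitEval_formIncrement,
      limitEval_mon_tr, e, List.map_cons, List.map_cons, listWeight_cons, weight, List.prod_cons]
    cases listWeight (l.map tr) with
    | zero => simp; ring
    | succ W =>
      rw [show a + 1 + (W + 1) - 1 = a + (W + 1) by omega, Nat.add_sub_cancel]
      push_cast
      ring

/-- Taylor remainder of second order, uniform on the unit disc: it bounds the truncation error of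
one Euler step. -/
theorem exists_norm_add_pow_sub_le (m : ℕ) : ∃ C : ℝ, ∀ t h : ℂ, ‖t‖ ≤ 1 → ‖h‖ ≤ 1 →
    ‖(t + h) ^ (m + 1) - t ^ (m + 1) - (m + 1) * t ^ m * h‖ ≤ C * ‖h‖ ^ 2 := by
  induction m with
  | zero => exact ⟨0, fun t h _ _ => by simp⟩
  | succ m ih =>
    obtain ⟨C, hC⟩ := ih
    refine ⟨(m + 1) + 2 * C, fun t h ht hh => ?_⟩
    have e : (t + h) ^ (m + 1 + 1) - t ^ (m + 1 + 1) - ((m + 1 : ℕ) + 1) * t ^ (m + 1) * h =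
        (m + 1) * t ^ m * h ^ 2 +
        (t + h) * ((t + h) ^ (m + 1) - t ^ (m + 1) - (m + 1) * t ^ m * h) := by
      push_cast
      ring
    rw [e, add_mul ((m : ℝ) + 1)]
    refine (norm_add_le _ _).trans (add_le_add ?_ ?_)
    · rw [norm_mul, norm_mul, norm_pow, norm_pow]
      gcongr
      have h1 : ‖(m : ℂ) + 1‖ = m + 1 := by
        rw [show (m : ℂ) + 1 = ((m + 1 : ℕ) : ℂ) by push_cast; rfl, Complex.norm_natCast]
        push_cast
        rfl
      rw [h1]
      exact mul_le_of_le_one_right (by positivity) (pow_le_one₀ (norm_nonneg _) ht)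
    · rw [norm_mul, mul_assoc (2 : ℝ)]
      refine mul_le_mul ?_ (hC t h ht hh) (norm_nonneg _) (by norm_num)
      exact (norm_add_le _ _).trans (by linarith)

theorem mixedMoment_succ_mon_tr {n k : ℕ} (hk : k < n) (l : List ℕ) :
    mixedMoment n (k + 1) (mon (l.map tr)) =
      mixedMoment n k (mon (l.map tr)) + 1 / (n : ℂ) * mixedMoment n k (increment l) := by
  rw [← mixedMoment_scale_mul, ← map_add, ← shift_mon_tr]
  simp only [mixedMoment, LinearMap.comp_apply, AlgHom.toLinearMap_apply]
  rw [realize_shift_tr _ hk]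

/-- Products of traces converge at rate `1 / n` if all polynomials of smaller weight do. -/
theorem exists_norm_mixedMoment_mon_tr_sub_le (l : List ℕ)
    (hl : ∀ w, w < listWeight (l.map tr) → weightLE w ≤ asymptotic) :
    ∃ C : ℝ, ∀ n k : ℕ, 0 < n → k ≤ n →
      ‖mixedMoment n k (mon (l.map tr)) - limitEval ((k : ℂ) / n) (mon (l.map tr))‖ ≤ C / n := by
  cases l with
  | nil =>
    refine ⟨0, fun n k _ _ => ?_⟩
    simp [mixedMoment, mon, gaussianExpectation_one]
  | cons a l =>
    obtain ⟨w, hw⟩ : ∃ w, listWeight ((a :: l).map tr) = w + 1 :=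
      ⟨a + listWeight (l.map tr), by rw [List.map_cons, listWeight_cons, weight]; omega⟩
    obtain ⟨C, hC⟩ := hl w (by omega) (increment_mem_weightLE (a :: l) hw.le)
    obtain ⟨D, hD⟩ := exists_norm_add_pow_sub_le w
    set K : ℂ := ((a :: l).map treeMoment).prod with hK
    have hlim : ∀ t, limitEval t (mon ((a :: l).map tr)) = K * t ^ (w + 1) := by
      intro t
      rw [limitEval_mon_tr, hw]
    have hinc : ∀ t, limitEval t (increment (a :: l)) = K * ((w + 1) * t ^ w) := by
      intro t
      rw [limitEval_increment, hw]
      push_cast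
      rfl
    -- Errors accumulate linearly: each step adds `C/n²` from the expected increment (weight `w`)
    -- and `‖K‖ D/n²` from the Taylor remainder.
    have key : ∀ n k : ℕ, 0 < n → k ≤ n →
        ‖mixedMoment n k (mon ((a :: l).map tr)) - K * ((k : ℂ) / n) ^ (w + 1)‖ ≤
          k * ((C + ‖K‖ * D) / (n : ℝ) ^ 2) := by
      intro n k hn
      have hn1 : (1 : ℝ) ≤ n := by exact_mod_cast hn
      induction k with
      | zero =>
        intro _
        -- The list is nonempty and every trace over zero columns vanishes, so the scheme starts
        -- without error.
        have : mixedMoment n 0 (mon ((a :: l).map tr)) = 0 := by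
          simp [mixedMoment, mon_cons, realize, gramTrace_zero]
        rw [this]
        simp
      | succ k ih =>
        intro hk
        have h1 := ih (by omega)
        have h2 := hC n k hk
        rw [hinc] at h2
        have hnorm : ‖1 / (n : ℂ)‖ = 1 / n := by simp
        have h3 := hD ((k : ℂ) / n) (1 / n) (norm_natCast_div_le_one (by omega))
          (by rw [hnorm]; exact div_le_one_of_le₀ hn1 (by linarith))
        rw [hnorm] at h3
        have e : mixedMoment n (k + 1) (mon ((a :: l).map tr)) -
            K * (((k + 1 : ℕ) : ℂ) / n) ^ (w + 1) =
            (mixedMoment n k (mon ((a :: l).map tr)) - K * ((k : ℂ) / n) ^ (w + 1)) +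
            (1 / (n : ℂ) * (mixedMoment n k (increment (a :: l)) -
              K * ((w + 1) * ((k : ℂ) / n) ^ w)) -
            K * (((k : ℂ) / n + 1 / n) ^ (w + 1) - ((k : ℂ) / n) ^ (w + 1) -
              (w + 1) * ((k : ℂ) / n) ^ w * (1 / n))) := by
          rw [mixedMoment_succ_mon_tr hk]
          push_cast
          rw [add_div]
          ring
        rw [e]
        refine (norm_add_le _ _).trans ?_
        push_cast
        rw [add_mul (k : ℝ), one_mul]
        refine add_le_add h1 ((norm_sub_le _ _).trans ?_)
        rw [norm_mul, norm_mul, hnorm, add_div]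
        refine add_le_add ?_ ?_
        · calc 1 / (n : ℝ) * _ ≤ 1 / (n : ℝ) * (C / n) := by gcongr
            _ = C / (n : ℝ) ^ 2 := by field_simp
        · calc ‖K‖ * _ ≤ ‖K‖ * (D * (1 / (n : ℝ)) ^ 2) := by gcongr
            _ = ‖K‖ * D / (n : ℝ) ^ 2 := by field_simp
    refine ⟨|C + ‖K‖ * D|, fun n k hn hk => ?_⟩
    rw [hlim]
    refine (key n k hn hk).trans ?_
    have hn1 : (0 : ℝ) < n := by exact_mod_cast hn
    have hk1 : (k : ℝ) ≤ n := by exact_mod_cast hk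
    calc (k : ℝ) * ((C + ‖K‖ * D) / (n : ℝ) ^ 2) ≤ k * (|C + ‖K‖ * D| / (n : ℝ) ^ 2) :=
          mul_le_mul_of_nonneg_left
            (div_le_div_of_nonneg_right (le_abs_self _) (by positivity)) (by positivity)
      _ ≤ n * (|C + ‖K‖ * D| / (n : ℝ) ^ 2) := by gcongr
      _ = |C + ‖K‖ * D| / n := by field_simp

/-- The variables of `l₂` are consumed one by one: a `scale` gains `1/n`, a `tr` moves to `l₁`, and
a `form b` is exchanged for `tr b` of the same weight plus a correction of smaller weight. Only a
product of traces remains. -/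
theorem mon_mem_asymptotic (w : ℕ) (ih : ∀ w' < w, weightLE w' ≤ asymptotic)
    (l₂ : List TraceVar) (l₁ : List ℕ) (h : listWeight (l₁.map tr) + listWeight l₂ ≤ w) :
    mon (l₁.map tr) * mon l₂ ∈ asymptotic := by
  induction l₂ generalizing l₁ with
  | nil =>
    obtain ⟨C, hC⟩ := exists_norm_mixedMoment_mon_tr_sub_le l₁ fun w' hw' => ih w' (by omega)
    refine ⟨C, fun n k hk => ?_⟩
    have : mon (l₁.map tr) * mon [] = mon (l₁.map tr) := by simp [mon]
    rw [this]
    exact hC n k (by omega) hk.le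
  | cons i l₂ IH =>
    rw [listWeight_cons] at h
    rw [mon_cons, mul_left_comm]
    cases i with
    | scale => exact scale_mul_mem_asymptotic (IH l₁ (by omega))
    | tr a =>
      rw [← mul_assoc, ← mon_cons, ← List.map_cons]
      refine IH (a :: l₁) ?_
      rw [List.map_cons, listWeight_cons]
      omega
    | form b =>
      refine form_mul_mem_asymptotic ?_ ?_
      · rw [← mul_assoc, ← mon_cons, ← List.map_cons]
        refine IH (b :: l₁) ?_
        rw [List.map_cons, listWeight_cons]
        simp only [weight] at h ⊢
        omega
      · rw [← mon_append]
        refine ih _ ?_ (formDerivation_mon_mem_weightLE b _)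
        rw [listWeight_append]
        simp only [weight] at h
        omega

theorem weightLE_le_asymptotic (w : ℕ) : weightLE w ≤ asymptotic := by
  induction w using Nat.strong_induction_on with
  | _ w ih =>
    refine Submodule.span_le.mpr ?_
    rintro _ ⟨l, hl, rfl⟩
    have := mon_mem_asymptotic w ih l [] (by simpa [listWeight] using hl)
    simpa [mon] using this

theorem tendsto_mixedMoment_tr (p : ℕ) :
    Tendsto (fun n : ℕ => mixedMoment n n (MvPolynomial.X (tr p))) atTop (𝓝 (treeMoment p)) := by
  obtain ⟨C, hC⟩ := exists_norm_mixedMoment_mon_tr_sub_le [p] fun w _ => weightLE_le_asymptotic w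
  rw [tendsto_iff_norm_sub_tendsto_zero]
  refine squeeze_zero' (.of_forall fun _ => norm_nonneg _) ?_ (tendsto_const_div_atTop_nhds_zero_nat C)
  filter_upwards [eventually_gt_atTop 0] with n hn
  have h := hC n n hn le_rfl
  have hn' : (n : ℂ) ≠ 0 := by exact_mod_cast hn.ne'
  rw [div_self hn'] at h
  simpa [mon, limitEval] using h

end TraceVar

/-! ### The moments of the random matrices -/

theorem evalConj_entryCol {n : ℕ} (t : UpperIndex n → ℂ) (j i : Fin n) :
    evalConj t (entryCol false j.1 i) = upperMatrix t i j ∧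
      evalConj t (entryCol true j.1 i) = star (upperMatrix t i j) := by
  by_cases h : i < j
  · have h' : i.1 < j.1 ∧ j.1 < n := ⟨h, j.2⟩
    simp [entryCol, upperMatrix, h, evalConj]
  · have h' : ¬ (i.1 < j.1 ∧ j.1 < n) := fun h' => h h'.1
    simp [entryCol, upperMatrix, h]

theorem evalConj_partialGram {n : ℕ} (t : UpperIndex n → ℂ) :
    (partialGram n n).map (evalConj t) = upperMatrix t * star (upperMatrix t) := by
  ext i j
  rw [Matrix.map_apply, partialGram_apply, map_sum, Finset.sum_range, Matrix.mul_apply]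
  refine Finset.sum_congr rfl fun l _ => ?_
  rw [map_mul, (evalConj_entryCol t l i).1, (evalConj_entryCol t l j).2]
  rfl

theorem starWord_alternating {A : Type*} [Monoid A] [Star A] (z : A) (p : ℕ) :
    starWord z (List.replicate p [true, false]).flatten = (star z * z) ^ p := by
  induction p with
  | zero => simp [starWord]
  | succ p ih =>
    rw [List.replicate_succ, List.flatten_cons, pow_succ', ← ih]
    simp [starWord, mul_assoc]

/-- The column decomposition computes powers of `T T*`; cyclicity of the trace passes to `T* T`. -/
theorem trace_star_mul_self_pow {n : ℕ} (t : UpperIndex n → ℂ) (p : ℕ) :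
    ((star (upperMatrix t) * upperMatrix t) ^ (p + 1)).trace =
      evalConj t ((partialGram n n ^ (p + 1)).trace) := by
  have h1 : evalConj t ((partialGram n n ^ (p + 1)).trace) =
      (((partialGram n n).map (evalConj t)) ^ (p + 1)).trace := by
    have : ((partialGram n n).map (evalConj t)) ^ (p + 1) =
        (partialGram n n ^ (p + 1)).map (evalConj t) :=
      (map_pow (evalConj t).mapMatrix (partialGram n n) (p + 1)).symm
    rw [this, Matrix.trace, Matrix.trace, map_sum]
    rfl
  rw [h1, evalConj_partialGram, pow_succ, ← mul_assoc, Matrix.trace_mul_comm, ← mul_assoc,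
    ← mul_pow_mul, mul_assoc, ← pow_succ]

theorem dtMoment_dirac_zero (n : ℕ) (ε : List Bool) :
    dtMoment (Measure.dirac 0) 1 n ε =
      ∫ t, (starWord (upperMatrix t) ε).trace / (n : ℂ)
        ∂(Measure.pi fun _ : UpperIndex n => complexGaussian (1 / (n : ℝ≥0))) := by
  have h : (Measure.pi fun _ : Fin n => (Measure.dirac (0 : ℂ))) =
      Measure.dirac (fun _ => 0) := by
    refine Measure.pi_eq fun s hs => ?_
    rw [Measure.dirac_apply' _ (MeasurableSet.univ_pi hs)]
    simp only [Measure.dirac_apply' _ (hs _)]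
    by_cases H : ∀ i, (0 : ℂ) ∈ s i
    · rw [Set.indicator_of_mem (by simpa [Set.mem_pi] using H)]
      simp only [Pi.one_apply]
      exact (Finset.prod_eq_one fun i _ => Set.indicator_of_mem (H i) _).symm
    · obtain ⟨i, hi⟩ := not_forall.mp H
      rw [Set.indicator_of_notMem fun h => hi (Set.mem_univ_pi.mp h i)]
      exact (Finset.prod_eq_zero (Finset.mem_univ i) (Set.indicator_of_notMem hi _)).symm
  rw [dtMoment, dtLaw, h, Measure.dirac_prod, (measurableEmbedding_prodMk_left _).integral_map]
  congr 1
  funext t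
  have ht : dtMatrix 1 ((fun _ => 0, t) : DTSample n) = upperMatrix t := by
    rw [dtMatrix, show Matrix.diagonal (fun _ : Fin n => (0 : ℂ)) = 0 from Matrix.diagonal_zero]
    simp
  rw [ht]

/-- The variance `1/n` built into `gramTrace` is the normalization of the trace. -/
theorem dtMoment_eq_mixedMoment (n p : ℕ) :
    dtMoment (Measure.dirac 0) 1 n (List.replicate (p + 1) [true, false]).flatten =
      TraceVar.mixedMoment n n (MvPolynomial.X (TraceVar.tr (p + 1))) := by
  rw [dtMoment_dirac_zero]
  have h : TraceVar.realize (1 / (n : ℝ≥0)) n n (MvPolynomial.X (TraceVar.tr (p + 1))) =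
      gramTrace (1 / (n : ℝ≥0)) n n (p + 1) := by
    simp [TraceVar.realize]
  rw [TraceVar.mixedMoment, LinearMap.comp_apply, AlgHom.toLinearMap_apply, h, gramTrace_succ_exp]
  simp only [gaussianExpectation, LinearMap.coe_mk, AddHom.coe_mk]
  congr 1
  funext t
  rw [starWord_alternating, trace_star_mul_self_pow, map_mul, div_eq_inv_mul]
  simp [evalConj]

theorem mainTheorem8 {A : Type*} [Ring A] [StarRing A] [Algebra ℂ A] [StarModule ℂ A]
    (τ : A →ₗ[ℂ] ℂ) (hτ : IsStarProbability τ)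
    (T : A) (hT : IsDTElement τ (Measure.dirac 0) 1 T) :
    (∀ p : ℕ, 1 ≤ p → τ ((star T * T) ^ p) = (p : ℂ) ^ p / ((p + 1)! : ℂ)) ∧
    ∃ R : ℂ → ℂ, IsRTransform (distribution τ (star T * T)) R ∧
      ∀ᶠ z in 𝓝[≠] (0 : ℂ), R z = -1 / ((1 - z) * Complex.log (1 - z)) - 1 / z := by
  have hmom : ∀ p : ℕ, 1 ≤ p → τ ((star T * T) ^ p) = treeMoment p := by
    intro p hp
    obtain ⟨p, rfl⟩ := Nat.exists_eq_add_of_le' hp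
    have h1 := hT.tendsto_moment (List.replicate (p + 1) [true, false]).flatten
    simp only [dtMoment_eq_mixedMoment, starWord_alternating] at h1
    exact tendsto_nhds_unique h1 (TraceVar.tendsto_mixedMoment_tr (p + 1))
  refine ⟨hmom, exists_isRTransform fun p => ?_⟩
  cases p with
  -- The moment of order 0 matches `treeMoment 0` because `0 ^ 0 = 1`.
  | zero => simp [distribution, hτ.map_one, treeMoment]
  | succ p =>
    rw [← hmom (p + 1) (by omega)]
    simp [distribution]
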